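/- **Setting.** Let $c\ge 1$ be an integer, and let $b_j\ge 0$ $(j\ne 1)$ and $h_j\ge 0$ $(j\ge 1)$ satisfy $0<-b_1=\sum_{j\neq 1}b_j<\infty$, $b_0>0$, $\sum_{j\ge 2}b_j>0$ and $0<h:=\sum_{j\ge1}h_j<\infty$. On $\{0,1,2,\dots\}$ let $Q^*=(q^*_{ij})$ be the conservative $q$-matrix with $q^*_{i,i-1}=\min(i,c)b_0$, $q^*_{ii}=b_1-(\min(i,c)-1)b_0$, $q^*_{ij}=b_{j-i+1}$ $(j\ge i+1)$ for $i\ge1$ and all other entries $0$; let $Q_s$ have entries $q^{(s)}_{00}=-h$, $q^{(s)}_{0j}=h_j$ $(j\ge1)$ and all other entries $0$; and put $\tilde Q=Q^*+Q_s$. For $\beta>0$ let the queue with $q$-matrix $\tilde Q$ be subject in addition to catastrophes, which in every state $i\ge1$ occur at rate $\beta$ (these are the effective ones, since they find the system non-empty), and let $C_{j0}$ be the time of the first effective catastrophe when the queue starts in state $j$. That is, $C_{j0}$ is the hitting time of $-1$, from the initial state $j$, of the Markov chain with right-continuous paths on $\{-1,0,1,\dots\}$ whose rates are those of $\tilde Q$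 on $\{0,1,2,\dots\}$ together with jumps at rate $\beta$ from each $i\ge1$ to the absorbing state $-1$. Put $B_c(s)=\sum_{j\ge0}b_js^j+(c-1)b_0(1-s)$, $B_c'(1)=\sum_{j\ge1}jb_j-(c-1)b_0\in(-\infty,\infty]$, $H(s)=\sum_{j\ge1}h_js^j$ and $\mu_1=\sum_{j\ge1}jh_j\in[0,\infty]$; let $u$ be the smallest root of $B_c(s)=0$ in $[0,1]$. With $(p^*_{ij}(t))$ the transition function of $Q^*$, put $m^*_i(k)=\int_0^\infty p^*_{ki}(t)\,dt$ and $r_k=\sum_{i\ge1}h_i\,m^*_k(i)$ for $i,k\ge 1$. **Theorem.** All the quantities $E(C_{j0})$ $(\beta>0,\ j\ge0)$, $m_k^*(i)$ and $r_k$ $(k,i\ge1)$ are finite, and the following hold. (i) If $B_c'(1)<0$ and $\mu_1<\infty$, then for every $j\ge0$ $$\lim_{\beta\downarrow0}\beta E(C_{j0})=\frac{-B_c'(1)+\mu_1+\sum_{k=1}^{c-1}r_k(c-k)b_0}{\mu_1+\sum_{k=1}^{c-1}r_k(c-k)b_0}=\frac1{1-\tilde\pi_0},$$ where $\tilde\pi$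 is an equilibrium distribution of $\tilde Q$ (a probability distribution with $\tilde\pi\tilde Q=0$); such a $\tilde\pi$ exists, and $\tilde\pi_0<1$ for each such $\tilde\pi$. (ii) If $B_c'(1)>0$, then, with $D:=h-H(u)+\sum_{k=1}^{c-1}u^{k-1}(c-k)b_0(1-u)r_k$, $$\lim_{\beta\downarrow0}\Big\{E(C_{00})-\frac1\beta\Big\}=\frac1D,\qquad \lim_{\beta\downarrow0}\Big\{E(C_{j0})-\frac1\beta\Big\}=\frac{b_0m_1^*(j)}{D}\quad(j\ge1).$$ (iii) Without any condition on $B_c'(1)$ or $\mu_1$, $$\lim_{\beta\to\infty}E(C_{00})=\frac1h,\qquad \lim_{\beta\to\infty}\beta E(C_{10})=1+\frac{b_0}{h},\qquad \lim_{\beta\to\infty}\beta E(C_{j0})=1\quad(j\ge2).$$ -/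

import Mathlib

open MeasureTheory Filter Topology
open scoped ENNReal NNReal

noncomputable section

namespace MXMc

/-! ### Markov jump processes with a given q-matrix on a countable state space -/

/-- Probability that the chain with q-matrix `Q` started at `i` is at `j` at time `t ≥ 0` after at
most `n` jumps, by decomposing according to the first jump:
`F₀(t) i j = δ_ij e^{q_ii t}` and
`F_{n+1}(t) i j = δ_ij e^{q_ii t} + ∫₀ᵗ e^{q_ii s} ∑_{k ≠ i} q_ik F_n(t - s) k j ds`. -/
def fellerIter {S : Type*} [DecidableEq S] (Q : S → S → ℝ) : ℕ → ℝ → S → S → ℝ≥0∞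
  | 0 => fun t i j => if i = j then ENNReal.ofReal (Real.exp (Q i i * t)) else 0
  | n + 1 => fun t i j =>
      (if i = j then ENNReal.ofReal (Real.exp (Q i i * t)) else 0) +
        ∫⁻ s in Set.Icc 0 t, ENNReal.ofReal (Real.exp (Q i i * s)) *
          ∑' k, (if k = i then 0 else ENNReal.ofReal (Q i k) * fellerIter Q n (t - s) k j)

/-- The Feller minimal transition function `p_ij(t)` of the q-matrix `Q`, i.e. the `Q`-function
(all q-matrices used below are bounded, so that the `Q`-function is unique). -/
def transFun {S : Type*} [DecidableEq S] (Q : S → S → ℝ) (t : ℝ) (i j : S) : ℝ≥0∞ :=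
  ⨆ n, fellerIter Q n t i j

/-- `M` is, under the probability measure `P`, the `Q`-process started at `i₀`: a process with
right-continuous (for the discrete topology) paths whose finite-dimensional distributions are those
of the Markov chain with transition function `transFun Q` and initial state `i₀`. -/
structure IsQProcess {S Ω : Type*} [DecidableEq S] [MeasurableSpace Ω] (Q : S → S → ℝ) (i₀ : S)
    (P : Measure Ω) (M : ℝ≥0 → Ω → S) : Prop where
  isProbabilityMeasure : IsProbabilityMeasure P
  measurableSet_eq : ∀ t x, MeasurableSet {ω | M t ω = x}
  rightContinuous : ∀ ω t, ∀ᶠ s in 𝓝[≥] t, M s ω = M t ω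
  finDimDistr : ∀ (n : ℕ) (t : ℕ → ℝ≥0) (x : ℕ → S), Monotone t → t 0 = 0 → x 0 = i₀ →
    P {ω | ∀ k ≤ n, M (t k) ω = x k} =
      ∏ k ∈ Finset.range n, transFun Q ((t (k + 1) : ℝ) - (t k : ℝ)) (x k) (x (k + 1))

/-- The first time at which the process `M` is in the state `x` (`∞` if there is none). -/
def hittingTime {S Ω : Type*} (M : ℝ≥0 → Ω → S) (x : S) (ω : Ω) : ℝ≥0∞ :=
  ⨅ t ∈ {t : ℝ≥0 | M t ω = x}, (t : ℝ≥0∞)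

/-- `π` is an equilibrium distribution for the (bounded, conservative) q-matrix `Q`: a probability
distribution with `π Q = 0`. -/
structure IsEquilibrium {S : Type*} (Q : S → S → ℝ) (π : S → ℝ) : Prop where
  nonneg : ∀ i, 0 ≤ π i
  hasSum_one : HasSum π 1
  balance : ∀ j, HasSum (fun i => π i * Q i j) 0

/-! ### The queueing model -/

/-- The parameters of the model: `c` servers, batch rates `b`, and resurrection rates `h`
(`h_j` only matters for `j ≥ 1`; by convention `h 0 = 0`), with `0 < ∑_{j ≥ 1} h_j < ∞` and
`0 < -b₁ = ∑_{j ≠ 1} b_j < ∞`. -/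
structure IsModel (c : ℕ) (b h : ℕ → ℝ) : Prop where
  one_le_c : 1 ≤ c
  b_nonneg : ∀ j, j ≠ 1 → 0 ≤ b j
  b_conservative : HasSum (fun j => if j = 1 then 0 else b j) (-b 1)
  b_zero_pos : 0 < b 0
  b_tail_pos : 0 < ∑' j, b (j + 2)
  h_zero : h 0 = 0
  h_nonneg : ∀ j, 0 ≤ h j
  h_summable : Summable h
  h_pos : 0 < ∑' j, h j

/-- The q-matrix `Q*` of the `M^X/M/c` queue stopped when it becomes empty. -/
def Qstar (c : ℕ) (b : ℕ → ℝ) (i j : ℕ) : ℝ :=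
  if i = 0 then 0
  else if j + 1 = i then ((min i c : ℕ) : ℝ) * b 0
  else if j = i then b 1 - (((min i c : ℕ) : ℝ) - 1) * b 0
  else if i + 1 ≤ j then b (j - i + 1)
  else 0

/-- The q-matrix `Q_s` of the arrivals at the empty system. -/
def Qs (h : ℕ → ℝ) (i j : ℕ) : ℝ :=
  if i = 0 then (if j = 0 then -∑' k, h k else h j) else 0

/-- The q-matrix `Q* + Q_s` of the queue with resurrection and without catastrophes. -/
def Qtilde (c : ℕ) (b h : ℕ → ℝ) (i j : ℕ) : ℝ :=
  Qstar c b i j + Qs h i j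

/-- Extension by zero of a matrix over `ℕ` to the state space `{-1, 0, 1, …}`, which is modelled
by `Option ℕ` with `none` in the role of `-1`. -/
def extendZero (Q : ℕ → ℕ → ℝ) : Option ℕ → Option ℕ → ℝ
  | some i, some j => Q i j
  | _, _ => 0

/-- Catastrophes at rate `β` in the states `i ≥ 1`, each leading to the state `-1`. -/
def QdBar (β : ℝ) : Option ℕ → Option ℕ → ℝ
  | some i, none => if 1 ≤ i then β else 0
  | some i, some j => if 1 ≤ i ∧ j = i then -β else 0
  | none, _ => 0

/-- The q-matrix on `{-1, 0, 1, …}` of the queue with resurrection in which an effective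
catastrophe, i.e. one that finds the system non-empty, leads to the absorbing state `-1`. -/
def QM (c : ℕ) (b h : ℕ → ℝ) (β : ℝ) (x y : Option ℕ) : ℝ :=
  extendZero (Qstar c b) x y + extendZero (Qs h) x y + QdBar β x y

/-! ### The quantities in the limits -/

/-- `B(s) = ∑ b_j s^j`. -/
def B (b : ℕ → ℝ) (s : ℝ) : ℝ := ∑' j, b j * s ^ j

/-- `B_i(s) = B(s) + (i - 1) b₀ (1 - s)`. -/
def Bi (b : ℕ → ℝ) (i : ℕ) (s : ℝ) : ℝ := B b s + ((i : ℝ) - 1) * b 0 * (1 - s)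

/-- `B_i'(1) = ∑_{j ≥ 1} j b_j - (i - 1) b₀ ∈ (-∞, +∞]`; the terms with `j ≥ 2` are nonnegative
and their sum may be infinite. -/
def BiDerivOne (b : ℕ → ℝ) (i : ℕ) : EReal :=
  ((b 1 - ((i : ℝ) - 1) * b 0 : ℝ) : EReal) +
    ((∑' j : ℕ, ENNReal.ofReal (((j + 2 : ℕ) : ℝ) * b (j + 2)) : ℝ≥0∞) : EReal)

/-- The smallest root `u` of `B_c(s) = 0` in `[0, 1]` (`s = 1` is a root and `B_c` is continuous on
`[0, 1]`, so the infimum is attained). -/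
def smallestRoot (c : ℕ) (b : ℕ → ℝ) : ℝ := sInf {s | 0 ≤ s ∧ s ≤ 1 ∧ Bi b c s = 0}

/-- `H(s) = ∑ h_j s^j`. -/
def H (h : ℕ → ℝ) (s : ℝ) : ℝ := ∑' j, h j * s ^ j

/-- `μ₁ = H'(1) = ∑ j h_j ∈ [0, ∞]`. -/
def mu1 (h : ℕ → ℝ) : ℝ≥0∞ := ∑' j : ℕ, ENNReal.ofReal ((j : ℝ) * h j)

/-- `m*_i(k) = ∫₀^∞ p*_ki(t) dt`. -/
def mstar (c : ℕ) (b : ℕ → ℝ) (i k : ℕ) : ℝ≥0∞ :=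
  ∫⁻ t in Set.Ici (0 : ℝ), transFun (Qstar c b) t k i

/-- `r_k = ∑_{i ≥ 1} h_i m*_k(i)`. -/
def r (c : ℕ) (b h : ℕ → ℝ) (k : ℕ) : ℝ≥0∞ :=
  ∑' i : ℕ, ENNReal.ofReal (h i) * mstar c b k i

/-- `∑_{k=1}^{c-1} r_k (c - k) b₀`. -/
def rSum (c : ℕ) (b h : ℕ → ℝ) : ℝ :=
  ∑ k ∈ Finset.Ico 1 c, (r c b h k).toReal * ((c : ℝ) - k) * b 0

/-- `h - H(u) + ∑_{k=1}^{c-1} u^{k-1} (c - k) b₀ (1 - u) r_k`, with `u` the smallest root. -/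
def transientDenom (c : ℕ) (b h : ℕ → ℝ) : ℝ :=
  (∑' j, h j) - H h (smallestRoot c b) +
    ∑ k ∈ Finset.Ico 1 c, smallestRoot c b ^ (k - 1) * ((c : ℝ) - k) * b 0 *
      (1 - smallestRoot c b) * (r c b h k).toReal

end MXMc

end

/-!
By first-step analysis `E(C_{j0})` is the minimal nonnegative solution of a linear system, and every
probability and every mean that occurs is such a minimal solution for the queue stopped when it
becomes empty. Let `e_j` be the probability that this queue empties before a catastrophe and `m_j`
the mean time until one of the two happens, so that `e_j + β m_j = 1`. The strong Markov property at
the first emptying gives `E(C_{j0}) = m_j + e_j E(C_{00})`, and together with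
`h E(C_{00}) = 1 + ∑ h_l E(C_{l0})` this yields `β E(C_{j0}) = 1 + e_j / A` with
`A = ∑ h_l m_l` and `β A = h - ∑ h_l e_l`.

As `β ↓ 0`, minimal solutions converge monotonically to those for `β = 0`. If `B_c'(1) < 0`, then
`e_j → 1`, and `A` is evaluated by the drift of the function `i ↦ i`; testing an equilibrium
distribution against `e` gives `π₀ A = 1 - π₀`. If `B_c'(1) > 0`, then
`E(C_{j0}) - 1 / β = e_j / (β A)`, and `u ^ i` solves the system up to a source at the levels
`1, …, c - 1`, which identifies `∑ h_l e_l`. As `β → ∞`, catastrophe times from non-empty states are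
`O(1 / β)`, and one step of the system gives the limits.
-/

noncomputable section

namespace MXMc

/-! ### Minimal nonnegative solutions of countable linear systems -/

section MinSol

variable {S ι : Type*}

/-- The operator whose fixed points `x = γ / d + step d a x` are the solutions of the linear system
`d i * x i = γ i + ∑ l, a i l * x l`. -/
def step (d : S → ℝ≥0∞) (a : S → S → ℝ≥0∞) (x : S → ℝ≥0∞) (i : S) : ℝ≥0∞ :=
  (∑' l, a i l * x l) / d i

/-- The minimal nonnegative solution of the system `d i * x i = γ i + ∑ l, a i l * x l`, given by
its Neumann series. -/
def minSol (d : S → ℝ≥0∞) (a : S → S → ℝ≥0∞) (γ : S → ℝ≥0∞) (i : S) : ℝ≥0∞ :=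
  ∑' n, (step d a)^[n] (γ / d) i

variable {d e : S → ℝ≥0∞} {a : S → S → ℝ≥0∞} {γ γ' x y : S → ℝ≥0∞}

lemma step_tsum (f : ι → S → ℝ≥0∞) :
    step d a (fun l => ∑' k, f k l) = fun i => ∑' k, step d a (f k) i := by
  ext i
  simp only [step, div_eq_mul_inv, ENNReal.tsum_mul_right, ← ENNReal.tsum_mul_left]
  rw [ENNReal.tsum_comm]

lemma step_const_mul (C : ℝ≥0∞) :
    step d a (fun l => C * x l) = fun i => C * step d a x i := by
  ext i
  simp only [step, mul_left_comm _ C, ENNReal.tsum_mul_left, mul_div_assoc]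

lemma step_add : step d a (x + y) = step d a x + step d a y := by
  ext i
  simp only [step, Pi.add_apply, mul_add, ENNReal.tsum_add, ENNReal.add_div]

lemma step_mono : Monotone (step d a) := by
  intro x y hxy i
  unfold step
  gcongr with l
  exact hxy l

lemma iterate_step_tsum (f : ι → S → ℝ≥0∞) (n : ℕ) :
    (step d a)^[n] (fun l => ∑' k, f k l) = fun i => ∑' k, (step d a)^[n] (f k) i := by
  induction n with
  | zero => rfl
  | succ n ih => simp only [Function.iterate_succ_apply', ih, step_tsum]

lemma iterate_step_const_mul (C : ℝ≥0∞) (n : ℕ) :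
    (step d a)^[n] (fun l => C * x l) = fun i => C * (step d a)^[n] x i := by
  induction n with
  | zero => rfl
  | succ n ih => simp only [Function.iterate_succ_apply', ih, step_const_mul]

lemma iterate_step_minSol (n : ℕ) (i : S) :
    (step d a)^[n] (minSol d a γ) i = ∑' m, (step d a)^[m + n] (γ / d) i := by
  refine (congrFun (iterate_step_tsum (fun m => (step d a)^[m] (γ / d)) n) i).trans ?_
  simp only [← Function.iterate_add_apply, add_comm n]

lemma sum_iterate_step_succ (n : ℕ) :
    ∑ m ∈ Finset.range (n + 1), (step d a)^[m] x =
      x + step d a (∑ m ∈ Finset.range n, (step d a)^[m] x) := by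
  induction n with
  | zero => ext; simp [step]
  | succ n ih =>
    rw [Finset.sum_range_succ, ih, add_assoc, Function.iterate_succ_apply', ← step_add,
      ← Finset.sum_range_succ, ih]

lemma minSol_tsum (f : ι → S → ℝ≥0∞) (i : S) :
    minSol d a (fun l => ∑' k, f k l) i = ∑' k, minSol d a (f k) i := by
  have hdiv : (fun l => ∑' k, f k l) / d = fun l => ∑' k, (f k / d) l := by
    ext l
    simp only [Pi.div_apply, div_eq_mul_inv, ENNReal.tsum_mul_right]
  simp only [minSol, hdiv, iterate_step_tsum]
  exact ENNReal.tsum_comm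

lemma minSol_const_mul (C : ℝ≥0∞) (i : S) :
    minSol d a (fun l => C * γ l) i = C * minSol d a γ i := by
  have hdiv : (fun l => C * γ l) / d = fun l => C * (γ / d) l :=
    funext fun l => mul_div_assoc C (γ l) (d l)
  simp only [minSol, hdiv, iterate_step_const_mul, ENNReal.tsum_mul_left]

lemma minSol_add (i : S) :
    minSol d a (fun l => γ l + γ' l) i = minSol d a γ i + minSol d a γ' i := by
  simpa [tsum_bool, add_comm] using minSol_tsum (d := d) (a := a) (fun b l => cond b (γ l) (γ' l)) i

lemma minSol_eq_tsum_single [DecidableEq S] (i : S) :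
    minSol d a γ i = ∑' k, γ k * minSol d a (Pi.single k 1) i := by
  have hγ : γ = fun l => ∑' k, γ k * (Pi.single k 1 : S → ℝ≥0∞) l := by
    ext l
    rw [tsum_eq_single l fun k hk => by simp [hk.symm]]
    simp
  simp only [← minSol_const_mul, ← minSol_tsum, ← hγ]

lemma minSol_eq_step (i : S) : minSol d a γ i = γ i / d i + step d a (minSol d a γ) i := by
  rw [minSol, tsum_eq_zero_add' ENNReal.summable]
  exact congrArg (γ i / d i + ·) (iterate_step_minSol 1 i).symm

/-- The forward equation, in contrast to `minSol_eq_step`: the recursion acts on the source. -/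
lemma minSol_eq_add_minSol (i : S) :
    minSol d a γ i = γ i / d i + minSol d a (fun i => ∑' l, a i l * (γ l / d l)) i := by
  rw [minSol, tsum_eq_zero_add' ENNReal.summable]
  rfl

lemma mul_minSol (hd₀ : ∀ i, d i ≠ 0) (hd : ∀ i, d i ≠ ∞) (i : S) :
    d i * minSol d a γ i = γ i + ∑' l, a i l * minSol d a γ l := by
  rw [minSol_eq_step, mul_add, step, ENNReal.mul_div_cancel (hd₀ i) (hd i),
    ENNReal.mul_div_cancel (hd₀ i) (hd i)]

lemma mul_minSol_single [DecidableEq S] (hd₀ : ∀ i, d i ≠ 0) (hd : ∀ i, d i ≠ ∞) (j k : S) :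
    d j * minSol d a (Pi.single j 1) k =
      (Pi.single j 1 : S → ℝ≥0∞) k + ∑' i, a i j * minSol d a (Pi.single i 1) k := by
  have hsource : (fun i => ∑' l, a i l * ((Pi.single j 1 : S → ℝ≥0∞) l / d l)) =
      fun i => (d j)⁻¹ * a i j := by
    ext i
    rw [tsum_eq_single j fun l hl => by simp [hl], Pi.single_eq_same, one_div, mul_comm]
  rw [minSol_eq_add_minSol, hsource, minSol_const_mul, mul_add, ← mul_assoc,
    ENNReal.mul_inv_cancel (hd₀ j) (hd j), one_mul, minSol_eq_tsum_single]
  congr 1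
  rcases eq_or_ne k j with rfl | hk
  · exact ENNReal.mul_div_cancel (hd₀ k) (hd k)
  · simp [hk]

lemma minSol_le (hx : ∀ i, γ i + ∑' l, a i l * x l ≤ d i * x i) (i : S) : minSol d a γ i ≤ x i := by
  have hsup : γ / d + step d a x ≤ x := fun i => by
    rw [Pi.add_apply, Pi.div_apply, step, ← ENNReal.add_div]
    exact ENNReal.div_le_of_le_mul' (hx i)
  have hpartial : ∀ n, ∑ m ∈ Finset.range n, (step d a)^[m] (γ / d) ≤ x := by
    intro n
    induction n with
    | zero => simp
    | succ n ih =>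
      rw [sum_iterate_step_succ]
      exact (add_le_add_right (step_mono ih) _).trans hsup
  rw [minSol, ENNReal.tsum_eq_iSup_nat]
  exact iSup_le fun n => by simpa only [Finset.sum_apply] using hpartial n i

lemma le_sum_add_iterate_step (hx : x ≤ y + step d a x) (n : ℕ) :
    x ≤ ∑ m ∈ Finset.range n, (step d a)^[m] y + (step d a)^[n] x := by
  induction n with
  | zero => simp
  | succ n ih =>
    rw [sum_iterate_step_succ, add_assoc, Function.iterate_succ_apply', ← step_add]
    exact hx.trans (add_le_add_right (step_mono ih) _)

/-- Without the domination by a minimal solution, which makes the remainders `step^[n] x` vanish, a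
subsolution may exceed the minimal solution by a solution of the homogeneous system. -/
lemma le_minSol (hd₀ : ∀ i, d i ≠ 0) (hd : ∀ i, d i ≠ ∞)
    (hx : ∀ i, d i * x i ≤ γ i + ∑' l, a i l * x l) {C : ℝ≥0∞} (hC : C ≠ ∞)
    (hdom : ∀ i, x i ≤ C * minSol d a γ' i) (i : S) (hfin : minSol d a γ' i ≠ ∞) :
    x i ≤ minSol d a γ i := by
  have hsub : x ≤ γ / d + step d a x := fun i => by
    rw [Pi.add_apply, Pi.div_apply, step, ← ENNReal.add_div,
      ENNReal.le_div_iff_mul_le (Or.inl (hd₀ i)) (Or.inl (hd i)), mul_comm]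
    exact hx i
  have hremainder : ∀ n, (step d a)^[n] x i ≤ C * ∑' m, (step d a)^[m + n] (γ' / d) i := by
    intro n
    rw [← iterate_step_minSol]
    exact (step_mono.iterate n hdom i).trans_eq (congrFun (iterate_step_const_mul C n) i)
  have htail : Tendsto (fun n => minSol d a γ i + C * ∑' m, (step d a)^[m + n] (γ' / d) i) atTop
      (𝓝 (minSol d a γ i + C * 0)) :=
    (ENNReal.Tendsto.const_mul (ENNReal.tendsto_sum_nat_add _ hfin) (Or.inr hC)).const_add _
  rw [mul_zero, add_zero] at htail
  refine ge_of_tendsto' htail fun n => (le_sum_add_iterate_step hsub n i).trans ?_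
  rw [Pi.add_apply, Finset.sum_apply]
  exact add_le_add (ENNReal.sum_le_tsum _) (hremainder n)

lemma minSol_mono (hγ : ∀ i, γ i ≤ γ' i) (i : S) : minSol d a γ i ≤ minSol d a γ' i :=
  ENNReal.tsum_le_tsum fun n => step_mono.iterate n (fun l => ENNReal.div_le_div_right (hγ l) _) i

/-- The coefficients `d` increased by killing at rate `β * e i` in the state `i`. -/
def killed (d e : S → ℝ≥0∞) (β : ℝ) (i : S) : ℝ≥0∞ := d i + ENNReal.ofReal β * e i

lemma killed_zero : killed d e 0 = d := by
  ext i
  simp [killed]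

lemma killed_ne_zero (hd₀ : ∀ i, d i ≠ 0) (β : ℝ) (i : S) : killed d e β i ≠ 0 := by
  simp [killed, hd₀]

lemma killed_ne_top (hd : ∀ i, d i ≠ ∞) (he : ∀ i, e i ≠ ∞) (β : ℝ) (i : S) :
    killed d e β i ≠ ∞ :=
  ENNReal.add_ne_top.2 ⟨hd i, ENNReal.mul_ne_top ENNReal.ofReal_ne_top (he i)⟩

lemma tendsto_killed {i : S} (he : e i ≠ ∞) :
    Tendsto (fun β => killed d e β i) (𝓝[>] 0) (𝓝 (d i)) := by
  have hβ : Tendsto ENNReal.ofReal (𝓝[>] 0) (𝓝 0) := by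
    simpa using (ENNReal.continuous_ofReal.tendsto 0).mono_left nhdsWithin_le_nhds
  simpa [killed] using (ENNReal.Tendsto.mul_const hβ (Or.inr he)).const_add (d i)

lemma minSol_killed_antitone (hd₀ : ∀ i, d i ≠ 0) (hd : ∀ i, d i ≠ ∞) (he : ∀ i, e i ≠ ∞)
    (i : S) : Antitone fun β => minSol (killed d e β) a γ i := by
  intro β β' hβ
  refine minSol_le (fun i => ?_) i
  rw [← mul_minSol (killed_ne_zero hd₀ β) (killed_ne_top hd he β)]
  unfold killed
  gcongr

lemma minSol_killed_le (hd₀ : ∀ i, d i ≠ 0) (hd : ∀ i, d i ≠ ∞) (he : ∀ i, e i ≠ ∞)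
    {β : ℝ} (hβ : 0 ≤ β) (i : S) : minSol (killed d e β) a γ i ≤ minSol d a γ i := by
  simpa only [killed_zero] using minSol_killed_antitone (a := a) (γ := γ) hd₀ hd he i hβ

lemma tendsto_minSol_killed (hd₀ : ∀ i, d i ≠ 0) (hd : ∀ i, d i ≠ ∞) (he : ∀ i, e i ≠ ∞)
    (ha : ∀ i l, a i l ≠ ∞) (i : S) :
    Tendsto (fun β => minSol (killed d e β) a γ i) (𝓝[>] 0) (𝓝 (minSol d a γ i)) := by
  set L : S → ℝ≥0∞ := fun i => sSup ((fun β => minSol (killed d e β) a γ i) '' Set.Ioi 0)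
  have hlim : ∀ i, Tendsto (fun β => minSol (killed d e β) a γ i) (𝓝[>] 0) (𝓝 (L i)) := fun i =>
    (minSol_killed_antitone hd₀ hd he i).tendsto_nhdsGT 0
  suffices hL : L i = minSol d a γ i from hL ▸ hlim i
  refine le_antisymm (sSup_le ?_) (minSol_le (fun i => ?_) i)
  · rintro _ ⟨β, hβ, rfl⟩
    exact minSol_killed_le hd₀ hd he hβ.le i
  · rw [ENNReal.tsum_eq_iSup_sum, ENNReal.add_iSup]
    refine iSup_le fun F => ?_
    have hpartial : Tendsto (fun β => γ i + ∑ l ∈ F, a i l * minSol (killed d e β) a γ l) (𝓝[>] 0)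
        (𝓝 (γ i + ∑ l ∈ F, a i l * L l)) :=
      (tendsto_finsetSum _ fun l _ =>
        ENNReal.Tendsto.const_mul (hlim l) (Or.inr (ha i l))).const_add _
    have hdiag : Tendsto (fun β => killed d e β i * minSol (killed d e β) a γ i) (𝓝[>] 0)
        (𝓝 (d i * L i)) :=
      ENNReal.Tendsto.mul (tendsto_killed (he i)) (Or.inl (hd₀ i)) (hlim i) (Or.inr (hd i))
    refine le_of_tendsto_of_tendsto' hpartial hdiag fun β => ?_
    rw [mul_minSol (killed_ne_zero hd₀ β) (killed_ne_top hd he β)]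
    gcongr
    exact ENNReal.sum_le_tsum _

lemma tendsto_tsum_minSol_killed (hd₀ : ∀ i, d i ≠ 0) (hd : ∀ i, d i ≠ ∞) (he : ∀ i, e i ≠ ∞)
    (ha : ∀ i l, a i l ≠ ∞) {w : S → ℝ≥0∞} (hw : ∀ i, w i ≠ ∞) :
    Tendsto (fun β => ∑' i, w i * minSol (killed d e β) a γ i) (𝓝[>] 0)
      (𝓝 (∑' i, w i * minSol d a γ i)) := by
  refine tendsto_order.2 ⟨fun r hr => ?_, fun r hr => ?_⟩
  · rw [ENNReal.tsum_eq_iSup_sum, lt_iSup_iff] at hr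
    obtain ⟨F, hF⟩ := hr
    have hpartial : Tendsto (fun β => ∑ i ∈ F, w i * minSol (killed d e β) a γ i) (𝓝[>] 0)
        (𝓝 (∑ i ∈ F, w i * minSol d a γ i)) :=
      tendsto_finsetSum _ fun l _ =>
        ENNReal.Tendsto.const_mul (tendsto_minSol_killed hd₀ hd he ha l) (Or.inr (hw l))
    filter_upwards [hpartial.eventually (lt_mem_nhds hF)] with β hβ
    exact hβ.trans_le (ENNReal.sum_le_tsum _)
  · filter_upwards [self_mem_nhdsWithin] with β hβ
    refine lt_of_le_of_lt ?_ hr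
    gcongr with i
    exact minSol_killed_le hd₀ hd he (le_of_lt hβ) i

end MinSol

/-! ### Green functions and mean hitting times of jump processes -/

section Green

lemma setLIntegral_Icc_eq_lconvolution (f g : ℝ → ℝ≥0∞) (t : ℝ) :
    ∫⁻ s in Set.Icc 0 t, f s * g (t - s) =
      ((Set.Ici 0).indicator f ⋆ₗ[volume] (Set.Ici 0).indicator g) t := by
  rw [lconvolution_def, ← lintegral_indicator measurableSet_Icc]
  congr 1 with s
  by_cases h₀ : 0 ≤ s <;> by_cases ht : s ≤ t <;> simp [Set.indicator, h₀, ht, neg_add_eq_sub]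

lemma measurable_setLIntegral_Icc_conv {f g : ℝ → ℝ≥0∞} (hf : Measurable f) (hg : Measurable g) :
    Measurable fun t => ∫⁻ s in Set.Icc 0 t, f s * g (t - s) := by
  simp only [setLIntegral_Icc_eq_lconvolution]
  exact measurable_lconvolution volume (hf.indicator measurableSet_Ici)
    (hg.indicator measurableSet_Ici)

lemma lintegral_lconvolution {f g : ℝ → ℝ≥0∞} (hf : Measurable f) (hg : Measurable g) :
    ∫⁻ t, (f ⋆ₗ[volume] g) t = (∫⁻ s, f s) * ∫⁻ t, g t := by
  simp only [lconvolution_def, neg_add_eq_sub]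
  rw [lintegral_lintegral_swap (by fun_prop), ← lintegral_mul_const _ hf]
  congr 1 with s
  rw [lintegral_const_mul _ (by fun_prop), lintegral_sub_right_eq_self g s]

lemma setLIntegral_Ici_setLIntegral_Icc_conv {f g : ℝ → ℝ≥0∞} (hf : Measurable f)
    (hg : Measurable g) :
    ∫⁻ t in Set.Ici 0, ∫⁻ s in Set.Icc 0 t, f s * g (t - s) =
      (∫⁻ s in Set.Ici 0, f s) * ∫⁻ t in Set.Ici 0, g t := by
  have hneg : ∀ t ∉ Set.Ici (0 : ℝ), ∫⁻ s in Set.Icc 0 t, f s * g (t - s) = 0 := fun t ht => by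
    rw [Set.Icc_eq_empty ht, setLIntegral_empty]
  rw [setLIntegral_eq_of_support_subset (Function.support_subset_iff'.2 hneg)]
  simp only [setLIntegral_Icc_eq_lconvolution]
  rw [lintegral_lconvolution (hf.indicator measurableSet_Ici) (hg.indicator measurableSet_Ici),
    lintegral_indicator measurableSet_Ici, lintegral_indicator measurableSet_Ici]

lemma setLIntegral_Ici_exp_mul {q : ℝ} (hq : q < 0) :
    ∫⁻ s in Set.Ici 0, ENNReal.ofReal (Real.exp (q * s)) = (ENNReal.ofReal (-q))⁻¹ := by
  rw [← restrict_Ioi_eq_restrict_Ici, ← ofReal_integral_eq_lintegral_ofReal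
    (integrableOn_exp_mul_Ioi hq 0) (ae_of_all _ fun _ => (Real.exp_pos _).le),
    integral_exp_mul_Ioi hq, ← ENNReal.ofReal_inv_of_pos (neg_pos.2 hq), mul_zero, Real.exp_zero,
    inv_neg, neg_div, one_div]

variable {S : Type*} [DecidableEq S] {Q : S → S → ℝ}

lemma transFun_eq_zero_of_absorbing {o : S} (ho : ∀ k, Q o k = 0) {j : S} (hj : j ≠ o) (t : ℝ) :
    transFun Q t o j = 0 := by
  rw [transFun, ENNReal.iSup_eq_zero]
  rintro (_ | n) <;> simp [fellerIter, hj.symm, ho]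

lemma fellerIter_mono (t : ℝ) (i j : S) : Monotone fun n => fellerIter Q n t i j := by
  refine monotone_nat_of_le_succ fun n => ?_
  induction n generalizing t i with
  | zero => simp only [fellerIter]; exact le_self_add
  | succ n ih =>
    rw [fellerIter.eq_2 Q n, fellerIter.eq_2 Q (n + 1)]
    refine add_le_add_right (lintegral_mono fun s => mul_le_mul_right
      (ENNReal.tsum_le_tsum fun k => ?_) _) _
    split_ifs
    · exact le_rfl
    · exact mul_le_mul_right (ih _ _) _

/-- The exit rates of a q-matrix with absorbing state `o`. The value `1` at `o`, where the rate
is `0`, only serves to make all values invertible. -/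
def exitRate (Q : S → S → ℝ) (o i : S) : ℝ≥0∞ :=
  if i = o then 1 else ENNReal.ofReal (-Q i i)

/-- The off-diagonal part of a q-matrix, i.e. its jump rates. -/
def offDiag (Q : S → S → ℝ) (i k : S) : ℝ≥0∞ :=
  if k = i then 0 else ENNReal.ofReal (Q i k)

lemma exitRate_ne_top (o i : S) : exitRate Q o i ≠ ∞ := by
  unfold exitRate
  split_ifs <;> simp

lemma exitRate_ne_zero {o : S} (hQ : ∀ i, i ≠ o → Q i i < 0) (i : S) : exitRate Q o i ≠ 0 := by
  unfold exitRate
  split_ifs with hi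
  · exact one_ne_zero
  · simpa using hQ i hi

lemma fellerIter_succ (n : ℕ) (t : ℝ) (i j : S) :
    fellerIter Q (n + 1) t i j = fellerIter Q 0 t i j +
      ∫⁻ s in Set.Icc 0 t, ENNReal.ofReal (Real.exp (Q i i * s)) *
        ∑' k, offDiag Q i k * fellerIter Q n (t - s) k j := by
  simp only [fellerIter, offDiag, ite_mul, zero_mul]

lemma measurable_fellerIter_zero (i j : S) : Measurable fun t => fellerIter Q 0 t i j := by
  simp only [fellerIter]
  split_ifs <;> fun_prop

lemma setLIntegral_Ici_fellerIter_zero {o : S} (hQ : ∀ i, i ≠ o → Q i i < 0) {j : S} (hj : j ≠ o)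
    (i : S) :
    ∫⁻ t in Set.Ici 0, fellerIter Q 0 t i j = (Pi.single j 1 / exitRate Q o : S → ℝ≥0∞) i := by
  rcases eq_or_ne i j with rfl | hij
  · simp [fellerIter, exitRate, hj, setLIntegral_Ici_exp_mul (hQ i hj)]
  · simp [fellerIter, hij]

variable [Countable S]

lemma measurable_fellerIter (n : ℕ) (i j : S) : Measurable fun t => fellerIter Q n t i j := by
  induction n generalizing i with
  | zero => exact measurable_fellerIter_zero i j
  | succ n ih =>
    simp only [fellerIter_succ]
    exact (measurable_fellerIter_zero i j).add <| measurable_setLIntegral_Icc_conv (by fun_prop) <|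
      Measurable.tsum fun k => (ih k).const_mul _

lemma measurable_transFun (i j : S) : Measurable fun t => transFun Q t i j :=
  Measurable.iSup fun n => measurable_fellerIter n i j

lemma setLIntegral_Ici_fellerIter_succ {o : S} (ho : ∀ k, Q o k = 0)
    (hQ : ∀ i, i ≠ o → Q i i < 0) {j : S} (hj : j ≠ o) (n : ℕ) (i : S) :
    ∫⁻ t in Set.Ici 0, fellerIter Q (n + 1) t i j =
      (Pi.single j 1 / exitRate Q o : S → ℝ≥0∞) i +
        step (exitRate Q o) (offDiag Q) (fun k => ∫⁻ t in Set.Ici 0, fellerIter Q n t k j) i := by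
  have hmeas : ∀ k, Measurable fun t => offDiag Q i k * fellerIter Q n t k j := fun k =>
    (measurable_fellerIter n k j).const_mul _
  simp only [fellerIter_succ]
  rw [lintegral_add_left (measurable_fellerIter_zero i j),
    setLIntegral_Ici_fellerIter_zero hQ hj, setLIntegral_Ici_setLIntegral_Icc_conv
      (g := fun t => ∑' k, offDiag Q i k * fellerIter Q n t k j) (by fun_prop)
      (Measurable.tsum hmeas),
    lintegral_tsum fun k => (hmeas k).aemeasurable]
  simp only [lintegral_const_mul _ (measurable_fellerIter n _ j)]
  congr 1
  rcases eq_or_ne i o with rfl | hi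
  · simp [step, offDiag, ho]
  · rw [setLIntegral_Ici_exp_mul (hQ i hi), step, exitRate, if_neg hi, ENNReal.div_eq_inv_mul]

lemma setLIntegral_Ici_fellerIter {o : S} (ho : ∀ k, Q o k = 0) (hQ : ∀ i, i ≠ o → Q i i < 0)
    {j : S} (hj : j ≠ o) (n : ℕ) :
    (fun i => ∫⁻ t in Set.Ici 0, fellerIter Q n t i j) = ∑ m ∈ Finset.range (n + 1),
      (step (exitRate Q o) (offDiag Q))^[m] (Pi.single j 1 / exitRate Q o) := by
  induction n with
  | zero =>
    ext i
    rw [setLIntegral_Ici_fellerIter_zero hQ hj]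
    simp
  | succ n ih =>
    rw [sum_iterate_step_succ, ← ih]
    ext i
    exact setLIntegral_Ici_fellerIter_succ ho hQ hj n i

lemma setLIntegral_Ici_transFun {o : S} (ho : ∀ k, Q o k = 0) (hQ : ∀ i, i ≠ o → Q i i < 0)
    {j : S} (hj : j ≠ o) (i : S) :
    ∫⁻ t in Set.Ici 0, transFun Q t i j =
      minSol (exitRate Q o) (offDiag Q) (Pi.single j 1) i := by
  simp only [transFun]
  rw [lintegral_iSup (fun n => measurable_fellerIter n i j)
    (fun m n hmn t => fellerIter_mono t i j hmn), minSol,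
    ENNReal.tsum_eq_iSup_nat' (tendsto_add_atTop_nat 1)]
  exact iSup_congr fun n => by
    rw [← Finset.sum_apply]
    exact congrFun (setLIntegral_Ici_fellerIter ho hQ hj n) i

end Green

section HittingTime

lemma setLIntegral_Ici_indicator_ofReal_lt (e : ℝ≥0∞) :
    ∫⁻ t in Set.Ici (0 : ℝ), {t : ℝ | ENNReal.ofReal t < e}.indicator 1 t = e := by
  have hmeas : MeasurableSet {t : ℝ | ENNReal.ofReal t < e} :=
    measurableSet_lt ENNReal.measurable_ofReal measurable_const
  rw [lintegral_indicator_one hmeas, Measure.restrict_apply hmeas]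
  induction e with
  | top => simp
  | coe e =>
    have hIco : {t : ℝ | ENNReal.ofReal t < e} ∩ Set.Ici 0 = Set.Ico 0 (e : ℝ) := by
      ext t
      simp +contextual [ENNReal.ofReal_lt_coe_iff, and_comm]
    rw [hIco, Real.volume_Ico, sub_zero, ENNReal.ofReal_coe_nnreal]

variable {Ω : Type*} [MeasurableSpace Ω] {P : Measure Ω}

lemma lintegral_eq_setLIntegral_Ici_meas_lt [SFinite P] {C : Ω → ℝ≥0∞} (hC : Measurable C) :
    ∫⁻ ω, C ω ∂P = ∫⁻ t in Set.Ici (0 : ℝ), P {ω | ENNReal.ofReal t < C ω} := by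
  have hmeas : MeasurableSet {p : Ω × ℝ | ENNReal.ofReal p.2 < C p.1} :=
    measurableSet_lt (by fun_prop) (by fun_prop)
  calc ∫⁻ ω, C ω ∂P
      = ∫⁻ ω, (∫⁻ t in Set.Ici (0 : ℝ),
          {p : Ω × ℝ | ENNReal.ofReal p.2 < C p.1}.indicator 1 (ω, t)) ∂P :=
        lintegral_congr fun ω => (setLIntegral_Ici_indicator_ofReal_lt (C ω)).symm
    _ = ∫⁻ t in Set.Ici (0 : ℝ), (∫⁻ ω,
          {p : Ω × ℝ | ENNReal.ofReal p.2 < C p.1}.indicator 1 (ω, t) ∂P) :=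
        lintegral_lintegral_swap (measurable_one.indicator hmeas).aemeasurable
    _ = ∫⁻ t in Set.Ici (0 : ℝ), P {ω | ENNReal.ofReal t < C ω} :=
        lintegral_congr fun t => by
          rw [← lintegral_indicator_one (measurableSet_lt measurable_const hC)]
          rfl

variable {S : Type*} [DecidableEq S] {Q : S → S → ℝ} {i₀ : S} {M : ℝ≥0 → Ω → S}

lemma hittingTime_le {Ω S : Type*} {M : ℝ≥0 → Ω → S} {x : S} {t : ℝ≥0} {ω : Ω} (h : M t ω = x) :
    hittingTime M x ω ≤ t :=
  iInf₂_le t h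

lemma IsQProcess.hittingTime_lt_iff (hM : IsQProcess Q i₀ P M) {x : S} {ω : Ω} {u : ℝ≥0∞} :
    hittingTime M x ω < u ↔ ∃ n, (TopologicalSpace.denseSeq ℝ≥0 n : ℝ≥0∞) < u ∧
      M (TopologicalSpace.denseSeq ℝ≥0 n) ω = x := by
  refine ⟨fun h => ?_, fun ⟨n, hnu, hn⟩ => (hittingTime_le hn).trans_lt hnu⟩
  simp only [hittingTime, iInf_lt_iff] at h
  obtain ⟨t, rfl, htu⟩ := h
  have hlt : ∀ᶠ s : ℝ≥0 in 𝓝[≥] t, (s : ℝ≥0∞) < u :=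
    nhdsWithin_le_nhds ((ENNReal.continuous_coe.tendsto t).eventually (gt_mem_nhds htu))
  obtain ⟨v, htv, hv⟩ := (mem_nhdsGE_iff_exists_Ico_subset' (lt_add_one t)).1
    (hlt.and (hM.rightContinuous ω t))
  obtain ⟨n, hn⟩ := (TopologicalSpace.denseRange_denseSeq ℝ≥0).exists_mem_open isOpen_Ioo
    (Set.nonempty_Ioo.2 htv)
  exact ⟨n, hv (Set.Ioo_subset_Ico_self hn)⟩

lemma IsQProcess.measurable_hittingTime (hM : IsQProcess Q i₀ P M) (x : S) :
    Measurable (hittingTime M x) := by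
  refine measurable_of_Iio fun u => ?_
  simp only [Set.preimage, Set.mem_Iio, hM.hittingTime_lt_iff, Set.ofPred_exists]
  exact MeasurableSet.iUnion fun n => (MeasurableSet.const _).inter (hM.measurableSet_eq _ x)

lemma IsQProcess.ae_zero_eq (hM : IsQProcess Q i₀ P M) : ∀ᵐ ω ∂P, M 0 ω = i₀ := by
  have := hM.isProbabilityMeasure
  refine (prob_compl_eq_zero_iff (hM.measurableSet_eq 0 i₀)).2 ?_
  simpa using hM.finDimDistr 0 (fun _ => 0) (fun _ => i₀) monotone_const rfl rfl

lemma IsQProcess.measure_eq (hM : IsQProcess Q i₀ P M) (t : ℝ≥0) (x : S) :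
    P {ω | M t ω = x} = transFun Q t i₀ x := by
  have hdistr := hM.finDimDistr 1 (fun | 0 => 0 | _ + 1 => t) (fun | 0 => i₀ | _ + 1 => x)
    (monotone_nat_of_le_succ fun | 0 => zero_le | _ + 1 => le_rfl) rfl rfl
  simp only [Finset.prod_range_one, NNReal.coe_zero, sub_zero] at hdistr
  rw [← hdistr]
  refine measure_congr (eventuallyEq_set.2 ?_)
  filter_upwards [hM.ae_zero_eq] with ω h₀
  refine ⟨fun h k hk => ?_, fun h => h 1 le_rfl⟩
  interval_cases k
  exacts [h₀, h]

lemma IsQProcess.measure_eq_and_eq (hM : IsQProcess Q i₀ P M) {s t : ℝ≥0} (hst : s ≤ t) (x y : S) :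
    P {ω | M s ω = x ∧ M t ω = y} = transFun Q s i₀ x * transFun Q (t - s) x y := by
  have hdistr := hM.finDimDistr 2 (fun | 0 => 0 | 1 => s | _ + 2 => t)
    (fun | 0 => i₀ | 1 => x | _ + 2 => y)
    (monotone_nat_of_le_succ fun | 0 => zero_le | 1 => hst | _ + 2 => le_rfl) rfl rfl
  simp only [Finset.prod_range_succ, Finset.prod_range_zero, one_mul, NNReal.coe_zero,
    sub_zero] at hdistr
  rw [← hdistr]
  refine measure_congr (eventuallyEq_set.2 ?_)
  filter_upwards [hM.ae_zero_eq] with ω h₀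
  refine ⟨fun h k hk => ?_, fun h => ⟨h 1 one_le_two, h 2 le_rfl⟩⟩
  interval_cases k
  exacts [h₀, h.1, h.2]

variable [Countable S] {o : S}

lemma IsQProcess.ae_eq_of_absorbing (hM : IsQProcess Q i₀ P M) (ho : ∀ k, Q o k = 0) {s t : ℝ≥0}
    (hst : s ≤ t) : ∀ᵐ ω ∂P, M s ω = o → M t ω = o := by
  have hnull : ∀ x, x ≠ o → ∀ᵐ ω ∂P, ¬ (M s ω = o ∧ M t ω = x) := fun x hx => by
    have hzero : P {ω | M s ω = o ∧ M t ω = x} = 0 := by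
      rw [hM.measure_eq_and_eq hst, transFun_eq_zero_of_absorbing ho hx, mul_zero]
    exact measure_eq_zero_iff_ae_notMem.1 hzero
  have hall : ∀ᵐ ω ∂P, ∀ x, x ≠ o → ¬ (M s ω = o ∧ M t ω = x) :=
    ae_all_iff.2 fun x => eventually_imp_distrib_left.2 (hnull x)
  filter_upwards [hall] with ω hω hs
  by_contra ht
  exact hω _ ht ⟨hs, rfl⟩

/-- Right continuity extends absorption from a countable dense set of times to all times. -/
lemma IsQProcess.ae_hittingTime_le_iff (hM : IsQProcess Q i₀ P M) (ho : ∀ k, Q o k = 0)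
    (t : ℝ≥0) : ∀ᵐ ω ∂P, hittingTime M o ω ≤ t ↔ M t ω = o := by
  have habsorbed : ∀ᵐ ω ∂P, ∀ n, TopologicalSpace.denseSeq ℝ≥0 n ≤ t →
      M (TopologicalSpace.denseSeq ℝ≥0 n) ω = o → M t ω = o :=
    ae_all_iff.2 fun n => eventually_imp_distrib_left.2 fun hn => hM.ae_eq_of_absorbing ho hn
  filter_upwards [habsorbed] with ω hω
  refine ⟨fun h => ?_, hittingTime_le⟩
  obtain ⟨v, htv, hv⟩ := (mem_nhdsGE_iff_exists_Ico_subset' (lt_add_one t)).1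
    (hM.rightContinuous ω t)
  obtain ⟨n, hnv, hn⟩ := hM.hittingTime_lt_iff.1 (h.trans_lt (ENNReal.coe_lt_coe.2 htv))
  rcases le_total (TopologicalSpace.denseSeq ℝ≥0 n) t with hnt | htn
  · exact hω n hnt hn
  · exact (hv ⟨htn, ENNReal.coe_lt_coe.1 hnv⟩).symm.trans hn

lemma IsQProcess.lintegral_hittingTime (hM : IsQProcess Q i₀ P M) (ho : ∀ k, Q o k = 0) :
    ∫⁻ ω, hittingTime M o ω ∂P = ∫⁻ t in Set.Ici (0 : ℝ), P {ω | M t.toNNReal ω ≠ o} := by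
  have := hM.isProbabilityMeasure
  rw [lintegral_eq_setLIntegral_Ici_meas_lt (hM.measurable_hittingTime o)]
  refine lintegral_congr fun t => measure_congr (eventuallyEq_set.2 ?_)
  filter_upwards [hM.ae_hittingTime_le_iff ho t.toNNReal] with ω hω
  exact not_le.symm.trans hω.not

lemma IsQProcess.measure_ne_eq_tsum (hM : IsQProcess Q i₀ P M) (t : ℝ≥0) (o : S) :
    P {ω | M t ω ≠ o} = ∑' x, (if x = o then 0 else 1) * transFun Q t i₀ x := by
  have hunion : {ω | M t ω ≠ o} = ⋃ x ∈ {x | x ≠ o}, {ω | M t ω = x} := by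
    ext ω
    simp
  have hdisj : ({x | x ≠ o}).PairwiseDisjoint fun x => {ω | M t ω = x} := fun x _ y _ hxy =>
    Set.disjoint_left.2 fun ω hx hy => hxy (hx.symm.trans hy)
  rw [hunion, measure_biUnion (Set.to_countable _) hdisj fun x _ => hM.measurableSet_eq t x,
    tsum_subtype {x | x ≠ o} fun x => P {ω | M t ω = x}]
  refine tsum_congr fun x => ?_
  by_cases hx : x = o <;> simp [Set.indicator, hx, hM.measure_eq]

theorem IsQProcess.lintegral_hittingTime_eq_minSol (hM : IsQProcess Q i₀ P M)
    (ho : ∀ k, Q o k = 0) (hQ : ∀ i, i ≠ o → Q i i < 0) :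
    ∫⁻ ω, hittingTime M o ω ∂P =
      minSol (exitRate Q o) (offDiag Q) (fun x => if x = o then 0 else 1) i₀ := by
  have hsurvival : ∀ t ∈ Set.Ici (0 : ℝ), P {ω | M t.toNNReal ω ≠ o} =
      ∑' x, (if x = o then 0 else 1) * transFun Q t i₀ x := fun t ht => by
    rw [hM.measure_ne_eq_tsum, Real.coe_toNNReal _ ht]
  rw [hM.lintegral_hittingTime ho, setLIntegral_congr_fun measurableSet_Ici hsurvival,
    lintegral_tsum fun x => ((measurable_transFun i₀ x).const_mul _).aemeasurable,
    minSol_eq_tsum_single]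
  refine tsum_congr fun x => ?_
  rw [lintegral_const_mul _ (measurable_transFun i₀ x)]
  split_ifs with hx
  · simp
  · rw [setLIntegral_Ici_transFun ho hQ hx]

end HittingTime

/-! ### The queue with catastrophes -/

section Queue

/-- The total departure rate in the state `i`. -/
def downRate (c : ℕ) (b : ℕ → ℝ) (i : ℕ) : ℝ≥0∞ :=
  ENNReal.ofReal (((min i c : ℕ) : ℝ) * b 0)

/-- The arrival rate of batches of size `j + 1`. -/
def upRate (b : ℕ → ℝ) (j : ℕ) : ℝ≥0∞ := ENNReal.ofReal (b (j + 2))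

/-- The total arrival rate. -/
def upTotal (b : ℕ → ℝ) : ℝ≥0∞ := ∑' j, upRate b j

/-- The exit rates of the stopped queue, with the value `1` at the absorbing state `0` as in
`exitRate`. -/
def baseRate (c : ℕ) (b : ℕ → ℝ) (i : ℕ) : ℝ≥0∞ :=
  if i = 0 then 1 else downRate c b i + upTotal b

/-- The jump rates of the stopped queue. -/
def jump (c : ℕ) (b : ℕ → ℝ) : ℕ → ℕ → ℝ≥0∞ := offDiag (Qstar c b)

/-- The indicator function of the states in which the system is non-empty. -/
def busy (i : ℕ) : ℝ≥0∞ := if i = 0 then 0 else 1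

/-- The exit rates of the stopped queue with catastrophes at rate `β`. -/
def killedRate (c : ℕ) (b : ℕ → ℝ) (β : ℝ) : ℕ → ℝ≥0∞ := killed (baseRate c b) busy β

/-- The probability that the queue started in the state `i` empties before a catastrophe. -/
def emptyProb (c : ℕ) (b : ℕ → ℝ) (β : ℝ) (i : ℕ) : ℝ≥0∞ :=
  minSol (killedRate c b β) (jump c b) (Pi.single 0 1) i

/-- The expected time until the queue started in the state `i` empties or suffers a catastrophe. -/
def busyTime (c : ℕ) (b : ℕ → ℝ) (β : ℝ) (i : ℕ) : ℝ≥0∞ :=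
  minSol (killedRate c b β) (jump c b) busy i

variable {c : ℕ} {b h : ℕ → ℝ} {β : ℝ}

lemma IsModel.b_add_two_nonneg (hm : IsModel c b h) (j : ℕ) : 0 ≤ b (j + 2) :=
  hm.b_nonneg _ (by omega)

lemma IsModel.hasSum_b_add_two (hm : IsModel c b h) :
    HasSum (fun j => b (j + 2)) (-b 1 - b 0) := by
  simpa [Finset.sum_range_succ] using (hasSum_nat_add_iff' 2).2 hm.b_conservative

lemma IsModel.upTotal_eq (hm : IsModel c b h) : upTotal b = ENNReal.ofReal (-b 1 - b 0) := by
  rw [← hm.hasSum_b_add_two.tsum_eq, ENNReal.ofReal_tsum_of_nonneg hm.b_add_two_nonneg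
    hm.hasSum_b_add_two.summable]
  rfl

lemma IsModel.upTotal_ne_top (hm : IsModel c b h) : upTotal b ≠ ∞ :=
  hm.upTotal_eq ▸ ENNReal.ofReal_ne_top

lemma IsModel.ofReal_b_zero_ne_zero (hm : IsModel c b h) : ENNReal.ofReal (b 0) ≠ 0 := by
  simpa using hm.b_zero_pos

lemma downRate_ne_top (i : ℕ) : downRate c b i ≠ ∞ := ENNReal.ofReal_ne_top

lemma IsModel.downRate_one (hm : IsModel c b h) : downRate c b 1 = ENNReal.ofReal (b 0) := by
  simp [downRate, hm.one_le_c]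

lemma IsModel.le_downRate (hm : IsModel c b h) {i : ℕ} (hi : i ≠ 0) :
    ENNReal.ofReal (b 0) ≤ downRate c b i := by
  have hmin : 1 ≤ min i c := le_min (Nat.one_le_iff_ne_zero.2 hi) hm.one_le_c
  exact ENNReal.ofReal_le_ofReal
    (le_mul_of_one_le_left hm.b_zero_pos.le (Nat.one_le_cast.2 hmin))

lemma IsModel.downRate_le (hm : IsModel c b h) (i : ℕ) :
    downRate c b i ≤ ENNReal.ofReal (c * b 0) :=
  ENNReal.ofReal_le_ofReal
    (mul_le_mul_of_nonneg_right (Nat.cast_le.2 (min_le_right i c)) hm.b_zero_pos.le)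

@[simp] lemma busy_zero : busy 0 = 0 := rfl

@[simp] lemma busy_succ (i : ℕ) : busy (i + 1) = 1 := rfl

lemma busy_ne_top (i : ℕ) : busy i ≠ ∞ := by
  cases i <;> simp

lemma IsModel.baseRate_ne_zero (hm : IsModel c b h) (i : ℕ) : baseRate c b i ≠ 0 := by
  unfold baseRate
  split_ifs with hi
  · exact one_ne_zero
  · exact ((pos_of_ne_zero hm.ofReal_b_zero_ne_zero).trans_le
      ((hm.le_downRate hi).trans le_self_add)).ne'

lemma IsModel.baseRate_ne_top (hm : IsModel c b h) (i : ℕ) : baseRate c b i ≠ ∞ := by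
  unfold baseRate
  split_ifs
  · exact ENNReal.one_ne_top
  · exact ENNReal.add_ne_top.2 ⟨downRate_ne_top i, hm.upTotal_ne_top⟩

lemma IsModel.killedRate_ne_zero (hm : IsModel c b h) (β : ℝ) (i : ℕ) : killedRate c b β i ≠ 0 :=
  killed_ne_zero hm.baseRate_ne_zero β i

lemma IsModel.killedRate_ne_top (hm : IsModel c b h) (β : ℝ) (i : ℕ) : killedRate c b β i ≠ ∞ :=
  killed_ne_top hm.baseRate_ne_top busy_ne_top β i

lemma killedRate_zero_left : killedRate c b 0 = baseRate c b := killed_zero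

@[simp] lemma killedRate_zero (β : ℝ) : killedRate c b β 0 = 1 := by
  simp [killedRate, killed, baseRate]

lemma killedRate_succ (β : ℝ) (i : ℕ) :
    killedRate c b β (i + 1) = downRate c b (i + 1) + upTotal b + ENNReal.ofReal β := by
  simp [killedRate, killed, baseRate]

lemma jump_ne_top (i l : ℕ) : jump c b i l ≠ ∞ := by
  unfold jump offDiag
  split_ifs <;> simp

@[simp] lemma jump_zero (l : ℕ) : jump c b 0 l = 0 := by
  simp [jump, offDiag, Qstar]

lemma jump_self (i : ℕ) : jump c b i i = 0 := by simp [jump, offDiag]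

lemma jump_down (i : ℕ) : jump c b (i + 1) i = downRate c b (i + 1) := by
  simp [jump, offDiag, Qstar, downRate]

lemma jump_up (i j : ℕ) : jump c b (i + 1) (j + (i + 2)) = upRate b j := by
  have hsize : j + (i + 2) - (i + 1) + 1 = j + 2 := by omega
  rw [jump, offDiag, if_neg (by omega), Qstar, if_neg (by omega), if_neg (by omega),
    if_neg (by omega), if_pos (by omega), hsize, upRate]

lemma jump_eq_zero {i l : ℕ} (hl : l < i) : jump c b (i + 1) l = 0 := by
  rw [jump, offDiag, if_neg (by omega), Qstar, if_neg (by omega), if_neg (by omega),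
    if_neg (by omega), if_neg (by omega), ENNReal.ofReal_zero]

lemma IsModel.jump_succ_zero_le (hm : IsModel c b h) (i : ℕ) :
    jump c b (i + 1) 0 ≤ ENNReal.ofReal (b 0) := by
  cases i with
  | zero => rw [jump_down, hm.downRate_one]
  | succ i => simp [jump_eq_zero]

lemma tsum_jump (x : ℕ → ℝ≥0∞) (i : ℕ) :
    ∑' l, jump c b (i + 1) l * x l =
      downRate c b (i + 1) * x i + ∑' j, upRate b j * x (j + (i + 2)) := by
  have hbelow : ∑ l ∈ Finset.range i, jump c b (i + 1) l * x l = 0 :=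
    Finset.sum_eq_zero fun l hl => by rw [jump_eq_zero (Finset.mem_range.1 hl), zero_mul]
  rw [← Summable.sum_add_tsum_nat_add' (f := fun l => jump c b (i + 1) l * x l) (k := i + 2)
    ENNReal.summable, Finset.sum_range_succ, Finset.sum_range_succ, hbelow, jump_self, jump_down]
  simp only [jump_up, zero_add, zero_mul, add_zero]

lemma tsum_jump_const (K : ℝ≥0∞) (i : ℕ) :
    ∑' l, jump c b (i + 1) l * K = (downRate c b (i + 1) + upTotal b) * K := by
  rw [tsum_jump (fun _ => K), ENNReal.tsum_mul_right, add_mul, upTotal]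

lemma IsModel.minSol_killedRate_self_ne_top (hm : IsModel c b h) (hβ : 0 < β) (i : ℕ) :
    minSol (killedRate c b β) (jump c b) (killedRate c b β) i ≠ ∞ := by
  set R := ENNReal.ofReal (c * b 0) + upTotal b
  have hβ₀ : ENNReal.ofReal β ≠ 0 := by simpa using hβ
  have hR : R ≠ ∞ := ENNReal.add_ne_top.2 ⟨ENNReal.ofReal_ne_top, hm.upTotal_ne_top⟩
  have hbound : minSol (killedRate c b β) (jump c b) (killedRate c b β) i ≤
      R / ENNReal.ofReal β + 1 := by
    refine minSol_le (x := fun _ => R / ENNReal.ofReal β + 1) (fun i => ?_) i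
    cases i with
    | zero => simp
    | succ i =>
      have hrate : killedRate c b β (i + 1) ≤
          ENNReal.ofReal β * (R / ENNReal.ofReal β + 1) := by
        rw [killedRate_succ, mul_add, ENNReal.mul_div_cancel hβ₀ ENNReal.ofReal_ne_top, mul_one]
        exact add_le_add_left (add_le_add_left (hm.downRate_le _) _) _
      rw [tsum_jump_const, add_comm]
      exact (add_le_add_right hrate _).trans_eq (by rw [killedRate_succ, ← add_mul])
  exact ne_top_of_le_ne_top
    (ENNReal.add_ne_top.2 ⟨(ENNReal.div_lt_top hR hβ₀).ne, ENNReal.one_ne_top⟩) hbound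

lemma IsModel.one_le_minSol_killedRate_self (hm : IsModel c b h) (β : ℝ) (i : ℕ) :
    1 ≤ minSol (killedRate c b β) (jump c b) (killedRate c b β) i := by
  rw [minSol_eq_step, ENNReal.div_self (hm.killedRate_ne_zero β i) (hm.killedRate_ne_top β i)]
  exact le_self_add

lemma IsModel.eq_minSol_of_bounded (hm : IsModel c b h) (hβ : 0 < β) {x γ : ℕ → ℝ≥0∞}
    (hx : ∀ i, killedRate c b β i * x i = γ i + ∑' l, jump c b i l * x l) {K : ℝ≥0∞} (hK : K ≠ ∞)
    (hxK : ∀ i, x i ≤ K) (i : ℕ) : x i = minSol (killedRate c b β) (jump c b) γ i := by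
  refine le_antisymm ?_ (minSol_le (fun i => (hx i).ge) i)
  refine le_minSol (hm.killedRate_ne_zero β) (hm.killedRate_ne_top β) (fun i => (hx i).le) hK
    (fun i => (hxK i).trans ?_) i (hm.minSol_killedRate_self_ne_top hβ i)
  exact le_mul_of_one_le_right' (hm.one_le_minSol_killedRate_self β i)

lemma killedRate_eq_add_tsum_jump (β : ℝ) (i : ℕ) :
    killedRate c b β i * 1 =
      ((Pi.single 0 1 : ℕ → ℝ≥0∞) i + ENNReal.ofReal β * busy i) + ∑' l, jump c b i l * 1 := by
  cases i with
  | zero => simp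
  | succ i =>
    rw [tsum_jump_const, killedRate_succ]
    simp [add_comm]

lemma IsModel.emptyProb_add_busyTime (hm : IsModel c b h) (hβ : 0 < β) (i : ℕ) :
    emptyProb c b β i + ENNReal.ofReal β * busyTime c b β i = 1 := by
  rw [hm.eq_minSol_of_bounded hβ (x := fun _ => 1) (killedRate_eq_add_tsum_jump β)
    ENNReal.one_ne_top (fun _ => le_rfl) i, minSol_add, minSol_const_mul]
  rfl

lemma emptyProb_le_one (β : ℝ) (i : ℕ) : emptyProb c b β i ≤ 1 := by
  refine minSol_le (x := fun _ => 1) (fun i => ?_) i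
  rw [killedRate_eq_add_tsum_jump]
  gcongr
  exact le_self_add

lemma emptyProb_ne_top (β : ℝ) (i : ℕ) : emptyProb c b β i ≠ ∞ :=
  ne_top_of_le_ne_top ENNReal.one_ne_top (emptyProb_le_one β i)

lemma IsModel.killedRate_mul_emptyProb (hm : IsModel c b h) (β : ℝ) (i : ℕ) :
    killedRate c b β i * emptyProb c b β i =
      (Pi.single 0 1 : ℕ → ℝ≥0∞) i + ∑' l, jump c b i l * emptyProb c b β l :=
  mul_minSol (hm.killedRate_ne_zero β) (hm.killedRate_ne_top β) i

lemma IsModel.emptyProb_zero (hm : IsModel c b h) (β : ℝ) : emptyProb c b β 0 = 1 := by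
  simpa using hm.killedRate_mul_emptyProb β 0

lemma IsModel.busyTime_ne_zero (hm : IsModel c b h) (β : ℝ) {l : ℕ} (hl : l ≠ 0) :
    busyTime c b β l ≠ 0 := by
  rw [busyTime, minSol_eq_step, busy, if_neg hl]
  simp [hm.killedRate_ne_top]

lemma IsModel.tendsto_minSol_killedRate (hm : IsModel c b h) (γ : ℕ → ℝ≥0∞) (i : ℕ) :
    Tendsto (fun β => minSol (killedRate c b β) (jump c b) γ i) (𝓝[>] 0)
      (𝓝 (minSol (killedRate c b 0) (jump c b) γ i)) :=
  killedRate_zero_left (c := c) ▸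
    tendsto_minSol_killed hm.baseRate_ne_zero hm.baseRate_ne_top busy_ne_top jump_ne_top i

lemma IsModel.tendsto_tsum_minSol_killedRate (hm : IsModel c b h) (γ : ℕ → ℝ≥0∞)
    {w : ℕ → ℝ≥0∞} (hw : ∀ i, w i ≠ ∞) :
    Tendsto (fun β => ∑' i, w i * minSol (killedRate c b β) (jump c b) γ i) (𝓝[>] 0)
      (𝓝 (∑' i, w i * minSol (killedRate c b 0) (jump c b) γ i)) :=
  killedRate_zero_left (c := c) ▸
    tendsto_tsum_minSol_killed hm.baseRate_ne_zero hm.baseRate_ne_top busy_ne_top jump_ne_top hw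

lemma Qstar_zero (k : ℕ) : Qstar c b 0 k = 0 := by simp [Qstar]

lemma IsModel.exitRate_Qstar (hm : IsModel c b h) : exitRate (Qstar c b) 0 = baseRate c b := by
  ext i
  unfold exitRate baseRate
  split_ifs with hi
  · rfl
  · rw [hm.upTotal_eq, downRate, ← ENNReal.ofReal_add
      (mul_nonneg (Nat.cast_nonneg _) hm.b_zero_pos.le)
      (hm.hasSum_b_add_two.nonneg hm.b_add_two_nonneg), Qstar, if_neg hi, if_neg (by omega),
      if_pos rfl]
    ring_nf

lemma IsModel.Qstar_self_neg (hm : IsModel c b h) {i : ℕ} (hi : i ≠ 0) : Qstar c b i i < 0 := by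
  have hrate := hm.baseRate_ne_zero i
  rw [← hm.exitRate_Qstar, exitRate, if_neg hi] at hrate
  simpa using hrate

end Queue

section CatastropheTime

variable {c : ℕ} {b h : ℕ → ℝ} {β : ℝ}

/-- The total rate of the arrivals at the empty system. -/
def restartTotal (h : ℕ → ℝ) : ℝ≥0∞ := ENNReal.ofReal (∑' j, h j)

/-- The expected time `E(C_{j0})` of the first effective catastrophe, as the minimal solution of
the first-step equations. -/
def catastropheTime (c : ℕ) (b h : ℕ → ℝ) (β : ℝ) (j : ℕ) : ℝ≥0∞ :=
  minSol (exitRate (QM c b h β) none) (offDiag (QM c b h β)) (fun x => if x = none then 0 else 1)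
    (some j)

/-- The bound for the expected time of the first effective catastrophe from a non-empty system
which is obtained by granting at most one visit to `0` in each period between catastrophes. -/
def catastropheBound (b h : ℕ → ℝ) (β : ℝ) : ℝ≥0∞ :=
  (1 + ENNReal.ofReal (b 0) / restartTotal h) / ENNReal.ofReal β

lemma IsModel.tsum_restart (hm : IsModel c b h) :
    ∑' l, ENNReal.ofReal (h l) = restartTotal h :=
  (ENNReal.ofReal_tsum_of_nonneg hm.h_nonneg hm.h_summable).symm

lemma IsModel.restartTotal_ne_zero (hm : IsModel c b h) : restartTotal h ≠ 0 := by
  simpa [restartTotal] using hm.h_pos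

lemma restartTotal_ne_top : restartTotal h ≠ ∞ := ENNReal.ofReal_ne_top

lemma tsum_option {f : Option ℕ → ℝ≥0∞} (hf : f none = 0) : ∑' x, f x = ∑' k, f (some k) := by
  refine ((Option.some_injective ℕ).tsum_eq fun x hx => ?_).symm
  rcases x with _ | k
  exacts [absurd hf hx, ⟨k, rfl⟩]

lemma QM_none (β : ℝ) (k : Option ℕ) : QM c b h β none k = 0 := by
  cases k <;> simp [QM, extendZero, QdBar]

lemma IsModel.offDiag_QM_zero_some (hm : IsModel c b h) (β : ℝ) (l : ℕ) :
    offDiag (QM c b h β) (some 0) (some l) = ENNReal.ofReal (h l) := by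
  cases l with
  | zero => simp [offDiag, hm.h_zero]
  | succ l => simp [offDiag, QM, extendZero, QdBar, Qstar, Qs]

lemma offDiag_QM_succ_some (β : ℝ) (i l : ℕ) :
    offDiag (QM c b h β) (some (i + 1)) (some l) = jump c b (i + 1) l := by
  by_cases hl : l = i + 1
  · simp [offDiag, jump, hl]
  · simp [offDiag, jump, hl, QM, extendZero, QdBar, Qs]

lemma exitRate_QM_zero (β : ℝ) : exitRate (QM c b h β) none (some 0) = restartTotal h := by
  simp [exitRate, QM, extendZero, QdBar, Qs, Qstar, restartTotal]

lemma IsModel.exitRate_QM_succ (hm : IsModel c b h) (hβ : 0 < β) (i : ℕ) :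
    exitRate (QM c b h β) none (some (i + 1)) = killedRate c b β (i + 1) := by
  rw [killedRate, killed, ← hm.exitRate_Qstar, exitRate, exitRate, if_neg (Option.some_ne_none _),
    if_neg i.succ_ne_zero, busy_succ, mul_one,
    ← ENNReal.ofReal_add (neg_nonneg.2 (hm.Qstar_self_neg i.succ_ne_zero).le) hβ.le]
  simp [QM, extendZero, QdBar, Qs, add_comm]

lemma IsModel.QM_self_neg (hm : IsModel c b h) (hβ : 0 < β) {x : Option ℕ} (hx : x ≠ none) :
    QM c b h β x x < 0 := by
  suffices hrate : exitRate (QM c b h β) none x ≠ 0 by simpa [exitRate, hx] using hrate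
  rcases x with _ | _ | i
  · exact absurd rfl hx
  · exact exitRate_QM_zero β ▸ hm.restartTotal_ne_zero
  · exact hm.exitRate_QM_succ hβ i ▸ hm.killedRate_ne_zero β (i + 1)

lemma IsModel.lintegral_hittingTime_none (hm : IsModel c b h) (hβ : 0 < β) {Ω : Type*}
    [MeasurableSpace Ω] {P : Measure Ω} {M : ℝ≥0 → Ω → Option ℕ} {j : ℕ}
    (hM : IsQProcess (QM c b h β) (some j) P M) :
    ∫⁻ ω, hittingTime M none ω ∂P = catastropheTime c b h β j :=
  hM.lintegral_hittingTime_eq_minSol (QM_none β) fun _ => hm.QM_self_neg hβ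

lemma IsModel.exitRate_QM_mul_catastropheTime (hm : IsModel c b h) (hβ : 0 < β) (j : ℕ) :
    exitRate (QM c b h β) none (some j) * catastropheTime c b h β j =
      1 + ∑' l, offDiag (QM c b h β) (some j) (some l) * catastropheTime c b h β l := by
  have hnone : minSol (exitRate (QM c b h β) none) (offDiag (QM c b h β))
      (fun x => if x = none then 0 else 1) none = 0 := by
    rw [minSol_eq_step, step]
    simp [offDiag, QM_none]
  have hrate₀ := exitRate_ne_zero (o := none) (Q := QM c b h β) fun _ => hm.QM_self_neg hβ
  rw [catastropheTime, mul_minSol hrate₀ (exitRate_ne_top none),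
    tsum_option (by rw [hnone, mul_zero])]
  rfl

lemma IsModel.restartTotal_mul_catastropheTime_zero (hm : IsModel c b h) (hβ : 0 < β) :
    restartTotal h * catastropheTime c b h β 0 =
      1 + ∑' l, ENNReal.ofReal (h l) * catastropheTime c b h β l := by
  simpa only [exitRate_QM_zero, hm.offDiag_QM_zero_some] using
    hm.exitRate_QM_mul_catastropheTime hβ 0

lemma IsModel.killedRate_mul_catastropheTime_succ (hm : IsModel c b h) (hβ : 0 < β) (i : ℕ) :
    killedRate c b β (i + 1) * catastropheTime c b h β (i + 1) =
      1 + ∑' l, jump c b (i + 1) l * catastropheTime c b h β l := by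
  simpa only [hm.exitRate_QM_succ hβ, offDiag_QM_succ_some] using
    hm.exitRate_QM_mul_catastropheTime hβ (i + 1)

lemma tsum_mul_add_single_zero (w : ℕ → ℝ≥0∞) (K L : ℝ≥0∞) :
    ∑' l, w l * (K + (Pi.single 0 L : ℕ → ℝ≥0∞) l) = (∑' l, w l) * K + w 0 * L := by
  simp only [mul_add, ENNReal.tsum_add, ENNReal.tsum_mul_right]
  rw [tsum_eq_single (f := fun l => w l * (Pi.single 0 L : ℕ → ℝ≥0∞) l) 0 fun l hl => by simp [hl],
    Pi.single_eq_same]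

lemma IsModel.catastropheTime_le (hm : IsModel c b h) (hβ : 0 < β) (j : ℕ) :
    catastropheTime c b h β j ≤
      catastropheBound b h β + (Pi.single 0 (restartTotal h)⁻¹ : ℕ → ℝ≥0∞) j := by
  set K := catastropheBound b h β
  have hβK : ENNReal.ofReal β * K = 1 + ENNReal.ofReal (b 0) * (restartTotal h)⁻¹ := by
    rw [← div_eq_mul_inv]
    exact ENNReal.mul_div_cancel (by simpa using hβ) ENNReal.ofReal_ne_top
  refine minSol_le (x := fun x => x.elim 0 fun j => K + (Pi.single 0 (restartTotal h)⁻¹ :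
    ℕ → ℝ≥0∞) j) (fun x => ?_) (some j)
  rw [tsum_option (mul_zero _)]
  rcases x with _ | _ | i
  · simp [offDiag, QM_none]
  · simp only [exitRate_QM_zero, hm.offDiag_QM_zero_some, Option.elim_some,
      tsum_mul_add_single_zero, hm.tsum_restart, hm.h_zero, Pi.single_eq_same]
    rw [mul_add, ENNReal.mul_inv_cancel hm.restartTotal_ne_zero restartTotal_ne_top]
    simp [add_comm]
  · simp only [hm.exitRate_QM_succ hβ, offDiag_QM_succ_some, Option.elim_some,
      tsum_mul_add_single_zero, Pi.single_eq_of_ne i.succ_ne_zero, add_zero, reduceCtorEq,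
      if_false]
    calc 1 + ((∑' l, jump c b (i + 1) l) * K + jump c b (i + 1) 0 * (restartTotal h)⁻¹)
        ≤ 1 + ((∑' l, jump c b (i + 1) l) * K + ENNReal.ofReal (b 0) * (restartTotal h)⁻¹) := by
          gcongr
          exact hm.jump_succ_zero_le i
      _ = (∑' l, jump c b (i + 1) l) * K + ENNReal.ofReal β * K := by rw [hβK]; ring
      _ = killedRate c b β (i + 1) * K := by
          rw [← ENNReal.tsum_mul_right, tsum_jump_const, killedRate_succ, ← add_mul]

lemma IsModel.catastropheTime_succ_le (hm : IsModel c b h) (hβ : 0 < β) (j : ℕ) :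
    catastropheTime c b h β (j + 1) ≤ catastropheBound b h β := by
  simpa using hm.catastropheTime_le hβ (j + 1)

lemma IsModel.catastropheBound_eq (hm : IsModel c b h) (hβ : 0 < β) :
    catastropheBound b h β = ENNReal.ofReal ((1 + b 0 / ∑' k, h k) / β) := by
  rw [catastropheBound, restartTotal, ← ENNReal.ofReal_div_of_pos hm.h_pos, ← ENNReal.ofReal_one,
    ← ENNReal.ofReal_add zero_le_one (div_nonneg hm.b_zero_pos.le hm.h_pos.le),
    ← ENNReal.ofReal_div_of_pos hβ]

lemma IsModel.catastropheTime_bounded (hm : IsModel c b h) (hβ : 0 < β) :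
    ∃ K ≠ ∞, ∀ j, catastropheTime c b h β j ≤ K := by
  refine ⟨catastropheBound b h β + (restartTotal h)⁻¹, ENNReal.add_ne_top.2
    ⟨hm.catastropheBound_eq hβ ▸ ENNReal.ofReal_ne_top,
      ENNReal.inv_ne_top.2 hm.restartTotal_ne_zero⟩,
    fun j => (hm.catastropheTime_le hβ j).trans ?_⟩
  cases j <;> simp

lemma IsModel.catastropheTime_ne_top (hm : IsModel c b h) (hβ : 0 < β) (j : ℕ) :
    catastropheTime c b h β j ≠ ∞ :=
  let ⟨_, hK, hle⟩ := hm.catastropheTime_bounded hβ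
  ne_top_of_le_ne_top hK (hle j)

end CatastropheTime

/-! ### The Green function of the stopped queue, and frequent catastrophes -/

section GreenFunction

variable {c : ℕ} {b h : ℕ → ℝ}

/-- The Green function of the stopped queue: the expected time spent in the state `i` when starting
in `k`. -/
def green (c : ℕ) (b : ℕ → ℝ) (i k : ℕ) : ℝ≥0∞ :=
  minSol (killedRate c b 0) (jump c b) (Pi.single i 1) k

lemma green_zero (k : ℕ) : green c b 0 k = emptyProb c b 0 k := rfl

lemma IsModel.killedRate_mul_green (hm : IsModel c b h) (j k : ℕ) :
    killedRate c b 0 j * green c b j k =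
      (Pi.single j 1 : ℕ → ℝ≥0∞) k + ∑' i, jump c b i j * green c b i k :=
  mul_minSol_single (hm.killedRate_ne_zero 0) (hm.killedRate_ne_top 0) j k

lemma IsModel.jump_mul_green_le (hm : IsModel c b h) (i j k : ℕ) :
    jump c b i j * green c b i k ≤ killedRate c b 0 j * green c b j k := by
  rw [hm.killedRate_mul_green]
  exact (ENNReal.le_tsum i).trans le_add_self

lemma IsModel.exists_green_le (hm : IsModel c b h) (i : ℕ) : ∃ C ≠ ∞, ∀ k, green c b i k ≤ C := by
  have hb := hm.ofReal_b_zero_ne_zero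
  induction i with
  | zero => exact ⟨1, ENNReal.one_ne_top, fun k => emptyProb_le_one 0 k⟩
  | succ i ih =>
    obtain ⟨C, hC, hle⟩ := ih
    refine ⟨killedRate c b 0 i * C / ENNReal.ofReal (b 0),
      (ENNReal.div_lt_top (ENNReal.mul_ne_top (hm.killedRate_ne_top 0 i) hC) hb).ne, fun k => ?_⟩
    rw [ENNReal.le_div_iff_mul_le (Or.inl hb) (Or.inl ENNReal.ofReal_ne_top), mul_comm]
    calc ENNReal.ofReal (b 0) * green c b (i + 1) k
        ≤ jump c b (i + 1) i * green c b (i + 1) k := by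
          gcongr
          exact jump_down (c := c) (b := b) i ▸ hm.le_downRate i.succ_ne_zero
      _ ≤ killedRate c b 0 i * green c b i k := hm.jump_mul_green_le (i + 1) i k
      _ ≤ killedRate c b 0 i * C := by
          gcongr
          exact hle k

lemma IsModel.green_ne_top (hm : IsModel c b h) (i k : ℕ) : green c b i k ≠ ∞ :=
  let ⟨_, hC, hle⟩ := hm.exists_green_le i
  ne_top_of_le_ne_top hC (hle k)

lemma IsModel.emptyProb_eq_mul_green_one (hm : IsModel c b h) {k : ℕ} (hk : k ≠ 0) :
    emptyProb c b 0 k = ENNReal.ofReal (b 0) * green c b 1 k := by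
  have hother : ∀ i ≠ 1, jump c b i 0 * green c b i k = 0 := by
    rintro (_ | _ | i) hi
    · simp
    · exact absurd rfl hi
    · rw [jump_eq_zero i.succ_pos, zero_mul]
  simpa [hk, green_zero, tsum_eq_single 1 hother, jump_down, hm.downRate_one] using
    hm.killedRate_mul_green 0 k

lemma IsModel.mstar_eq_green (hm : IsModel c b h) {i : ℕ} (hi : i ≠ 0) (k : ℕ) :
    mstar c b i k = green c b i k := by
  rw [mstar, setLIntegral_Ici_transFun Qstar_zero (fun _ => hm.Qstar_self_neg) hi,
    hm.exitRate_Qstar, ← killedRate_zero_left]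
  rfl

lemma IsModel.r_eq_tsum_green (hm : IsModel c b h) {k : ℕ} (hk : k ≠ 0) :
    r c b h k = ∑' i, ENNReal.ofReal (h i) * green c b k i := by
  simp only [r, hm.mstar_eq_green hk]

lemma IsModel.r_ne_top (hm : IsModel c b h) {k : ℕ} (hk : k ≠ 0) : r c b h k ≠ ∞ := by
  obtain ⟨C, hC, hle⟩ := hm.exists_green_le k
  refine ne_top_of_le_ne_top (ENNReal.mul_ne_top (restartTotal_ne_top (h := h)) hC) ?_
  rw [hm.r_eq_tsum_green hk, ← hm.tsum_restart, ← ENNReal.tsum_mul_right]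
  gcongr with i
  exact hle i

end GreenFunction

section LargeRate

variable {c : ℕ} {b h : ℕ → ℝ}

lemma IsModel.tendsto_catastropheBound (hm : IsModel c b h) :
    Tendsto (catastropheBound b h) atTop (𝓝 0) := by
  have hnum : 1 + ENNReal.ofReal (b 0) / restartTotal h ≠ ∞ := ENNReal.add_ne_top.2
    ⟨ENNReal.one_ne_top, (ENNReal.div_lt_top ENNReal.ofReal_ne_top hm.restartTotal_ne_zero).ne⟩
  exact ENNReal.div_top (a := 1 + ENNReal.ofReal (b 0) / restartTotal h) ▸
    ENNReal.Tendsto.const_div ENNReal.tendsto_ofReal_atTop (Or.inr hnum)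

lemma IsModel.tendsto_catastropheTime_succ_atTop (hm : IsModel c b h) (j : ℕ) :
    Tendsto (fun β => catastropheTime c b h β (j + 1)) atTop (𝓝 0) := by
  refine tendsto_of_tendsto_of_tendsto_of_le_of_le' tendsto_const_nhds hm.tendsto_catastropheBound
    (Eventually.of_forall fun _ => zero_le) ?_
  filter_upwards [eventually_gt_atTop 0] with β hβ using hm.catastropheTime_succ_le hβ j

lemma IsModel.tendsto_tsum_mul_catastropheTime_succ_atTop (hm : IsModel c b h) {w : ℕ → ℝ≥0∞}
    (hw : ∑' l, w l ≠ ∞) :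
    Tendsto (fun β => ∑' l, w l * catastropheTime c b h β (l + 1)) atTop (𝓝 0) := by
  have hbound : Tendsto (fun β => (∑' l, w l) * catastropheBound b h β) atTop (𝓝 0) := by
    simpa using ENNReal.Tendsto.const_mul hm.tendsto_catastropheBound (Or.inr hw)
  refine tendsto_of_tendsto_of_tendsto_of_le_of_le' tendsto_const_nhds hbound
    (Eventually.of_forall fun _ => zero_le) ?_
  filter_upwards [eventually_gt_atTop 0] with β hβ
  rw [← ENNReal.tsum_mul_right]
  gcongr with l
  exact hm.catastropheTime_succ_le hβ l

lemma IsModel.tendsto_catastropheTime_zero_atTop (hm : IsModel c b h) :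
    Tendsto (fun β => catastropheTime c b h β 0) atTop (𝓝 (restartTotal h)⁻¹) := by
  have hw : ∑' l, ENNReal.ofReal (h (l + 1)) ≠ ∞ := by
    refine ne_top_of_le_ne_top (restartTotal_ne_top (h := h)) ?_
    rw [← hm.tsum_restart]
    exact ENNReal.tsum_comp_le_tsum_of_injective (add_left_injective 1) _
  have hlim := (ENNReal.Tendsto.div_const
    ((hm.tendsto_tsum_mul_catastropheTime_succ_atTop hw).const_add 1)
    (Or.inr hm.restartTotal_ne_zero) : Tendsto _ _ (𝓝 ((1 + 0) / restartTotal h)))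
  rw [add_zero, one_div] at hlim
  refine hlim.congr' ?_
  filter_upwards [eventually_gt_atTop 0] with β hβ
  have hfirst := hm.restartTotal_mul_catastropheTime_zero hβ
  rw [tsum_eq_zero_add' ENNReal.summable, hm.h_zero, ENNReal.ofReal_zero, zero_mul,
    zero_add] at hfirst
  rw [← hfirst, ENNReal.mul_div_right_comm, ENNReal.div_self hm.restartTotal_ne_zero
    restartTotal_ne_top, one_mul]

lemma IsModel.tendsto_mul_catastropheTime_succ_atTop (hm : IsModel c b h) (j : ℕ) :
    Tendsto (fun β => ENNReal.ofReal β * catastropheTime c b h β (j + 1)) atTop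
      (𝓝 (1 + jump c b (j + 1) 0 / restartTotal h)) := by
  set q := downRate c b (j + 1) + upTotal b
  have hq : q ≠ ∞ := ENNReal.add_ne_top.2 ⟨downRate_ne_top _, hm.upTotal_ne_top⟩
  have hw : ∑' l, jump c b (j + 1) (l + 1) ≠ ∞ := by
    refine ne_top_of_le_ne_top hq ?_
    simpa using (ENNReal.tsum_comp_le_tsum_of_injective (add_left_injective 1) _).trans_eq
      (tsum_jump_const 1 j)
  have hqE : Tendsto (fun β => q * catastropheTime c b h β (j + 1)) atTop (𝓝 0) := by
    simpa using ENNReal.Tendsto.const_mul (hm.tendsto_catastropheTime_succ_atTop j) (Or.inr hq)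
  have hflow : Tendsto (fun β => 1 + (jump c b (j + 1) 0 * catastropheTime c b h β 0 +
      ∑' l, jump c b (j + 1) (l + 1) * catastropheTime c b h β (l + 1))) atTop
      (𝓝 (1 + jump c b (j + 1) 0 / restartTotal h)) := by
    simpa [div_eq_mul_inv] using ((ENNReal.Tendsto.const_mul hm.tendsto_catastropheTime_zero_atTop
      (Or.inr (jump_ne_top (j + 1) 0))).add
      (hm.tendsto_tsum_mul_catastropheTime_succ_atTop hw)).const_add 1
  have hlim := ENNReal.Tendsto.sub hflow hqE (Or.inr ENNReal.zero_ne_top)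
  rw [tsub_zero] at hlim
  refine hlim.congr' ?_
  filter_upwards [eventually_gt_atTop 0] with β hβ
  refine (ENNReal.eq_sub_of_add_eq (ENNReal.mul_ne_top hq (hm.catastropheTime_ne_top hβ _)) ?_).symm
  rw [← add_mul, add_comm, ← killedRate_succ, hm.killedRate_mul_catastropheTime_succ hβ,
    tsum_eq_zero_add' ENNReal.summable]

lemma IsModel.tendsto_toReal_catastropheTime_zero_atTop (hm : IsModel c b h) :
    Tendsto (fun β => (catastropheTime c b h β 0).toReal) atTop (𝓝 (1 / ∑' k, h k)) := by
  have hlim := (ENNReal.tendsto_toReal (ENNReal.inv_ne_top.2 hm.restartTotal_ne_zero)).comp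
    hm.tendsto_catastropheTime_zero_atTop
  rwa [ENNReal.toReal_inv, restartTotal, ENNReal.toReal_ofReal hm.h_pos.le, ← one_div] at hlim

lemma IsModel.tendsto_mul_toReal_catastropheTime_succ_atTop (hm : IsModel c b h) (j : ℕ) :
    Tendsto (fun β => β * (catastropheTime c b h β (j + 1)).toReal) atTop
      (𝓝 (1 + (jump c b (j + 1) 0).toReal / ∑' k, h k)) := by
  have hdiv := (ENNReal.div_lt_top (jump_ne_top (c := c) (b := b) (j + 1) 0)
    hm.restartTotal_ne_zero).ne
  have hlim := (ENNReal.tendsto_toReal (ENNReal.add_ne_top.2 ⟨ENNReal.one_ne_top, hdiv⟩)).comp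
    (hm.tendsto_mul_catastropheTime_succ_atTop j)
  rw [ENNReal.toReal_add ENNReal.one_ne_top hdiv, ENNReal.toReal_one, ENNReal.toReal_div,
    restartTotal, ENNReal.toReal_ofReal hm.h_pos.le] at hlim
  refine hlim.congr' ?_
  filter_upwards [eventually_gt_atTop 0] with β hβ
  simp [ENNReal.toReal_ofReal hβ.le]

lemma IsModel.tendsto_mul_toReal_catastropheTime_one_atTop (hm : IsModel c b h) :
    Tendsto (fun β => β * (catastropheTime c b h β 1).toReal) atTop (𝓝 (1 + b 0 / ∑' k, h k)) := by
  simpa [jump_down, hm.downRate_one, hm.b_zero_pos.le] using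
    hm.tendsto_mul_toReal_catastropheTime_succ_atTop 0

lemma IsModel.tendsto_mul_toReal_catastropheTime_add_two_atTop (hm : IsModel c b h) (j : ℕ) :
    Tendsto (fun β => β * (catastropheTime c b h β (j + 2)).toReal) atTop (𝓝 1) := by
  simpa [jump_eq_zero] using hm.tendsto_mul_toReal_catastropheTime_succ_atTop (j + 1)

end LargeRate

section Formula

variable {c : ℕ} {b h : ℕ → ℝ} {β : ℝ}

/-- The rate of the restarts from the empty system after which it empties again before a
catastrophe. -/
def restartEmpty (c : ℕ) (b h : ℕ → ℝ) (β : ℝ) : ℝ≥0∞ :=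
  ∑' l, ENNReal.ofReal (h l) * emptyProb c b β l

/-- The total restart rate times the expected duration of the busy period after a restart. -/
def restartBusy (c : ℕ) (b h : ℕ → ℝ) (β : ℝ) : ℝ≥0∞ :=
  ∑' l, ENNReal.ofReal (h l) * busyTime c b β l

lemma IsModel.restartEmpty_add_mul_restartBusy (hm : IsModel c b h) (hβ : 0 < β) :
    restartEmpty c b h β + ENNReal.ofReal β * restartBusy c b h β = restartTotal h := by
  rw [restartEmpty, restartBusy, ← ENNReal.tsum_mul_left, ← ENNReal.tsum_add, ← hm.tsum_restart]
  refine tsum_congr fun l => ?_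
  rw [mul_left_comm, ← mul_add, hm.emptyProb_add_busyTime hβ, mul_one]

lemma IsModel.restartEmpty_le (hm : IsModel c b h) (β : ℝ) :
    restartEmpty c b h β ≤ restartTotal h := by
  rw [restartEmpty, ← hm.tsum_restart]
  gcongr with l
  exact mul_le_of_le_one_right' (emptyProb_le_one β l)

lemma IsModel.restartEmpty_ne_top (hm : IsModel c b h) (β : ℝ) : restartEmpty c b h β ≠ ∞ :=
  ne_top_of_le_ne_top restartTotal_ne_top (hm.restartEmpty_le β)

lemma IsModel.exists_h_pos (hm : IsModel c b h) : ∃ l, l ≠ 0 ∧ 0 < h l := by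
  by_contra! hnonpos
  have hzero : ∀ l, h l = 0 := fun l => by
    rcases eq_or_ne l 0 with rfl | hl
    exacts [hm.h_zero, (hnonpos l hl).antisymm (hm.h_nonneg l)]
  simpa [hzero] using hm.h_pos

lemma IsModel.restartBusy_ne_zero (hm : IsModel c b h) (β : ℝ) : restartBusy c b h β ≠ 0 := by
  obtain ⟨l, hl, hpos⟩ := hm.exists_h_pos
  rw [restartBusy, ne_eq, ENNReal.tsum_eq_zero, not_forall]
  exact ⟨l, mul_ne_zero (by simpa using hpos) (hm.busyTime_ne_zero β hl)⟩

lemma IsModel.restartBusy_ne_top (hm : IsModel c b h) (hβ : 0 < β) : restartBusy c b h β ≠ ∞ := by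
  intro htop
  have hsum := hm.restartEmpty_add_mul_restartBusy hβ
  rw [htop, ENNReal.mul_top (by simpa using hβ), add_top] at hsum
  exact restartTotal_ne_top hsum.symm

lemma IsModel.catastropheTime_eq (hm : IsModel c b h) (hβ : 0 < β) (j : ℕ) :
    catastropheTime c b h β j =
      busyTime c b β j + catastropheTime c b h β 0 * emptyProb c b β j := by
  obtain ⟨K, hK, hle⟩ := hm.catastropheTime_bounded hβ
  rw [hm.eq_minSol_of_bounded hβ (x := catastropheTime c b h β)
    (γ := fun i => busy i + catastropheTime c b h β 0 * (Pi.single 0 1 : ℕ → ℝ≥0∞) i)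
    (fun i => ?_) hK hle j, minSol_add, minSol_const_mul]
  · rfl
  · cases i with
    | zero => simp
    | succ i => simpa using hm.killedRate_mul_catastropheTime_succ hβ i

lemma IsModel.mul_catastropheTime_zero (hm : IsModel c b h) (hβ : 0 < β) :
    ENNReal.ofReal β * catastropheTime c b h β 0 = 1 + 1 / restartBusy c b h β := by
  set E := catastropheTime c b h β 0
  set A := restartBusy c b h β
  set F := restartEmpty c b h β
  have hA₀ : A ≠ 0 := hm.restartBusy_ne_zero β
  have hA : A ≠ ∞ := hm.restartBusy_ne_top hβ
  have hfirst : restartTotal h * E = 1 + (A + E * F) := by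
    rw [hm.restartTotal_mul_catastropheTime_zero hβ, tsum_congr fun l =>
      congrArg (ENNReal.ofReal (h l) * ·) (hm.catastropheTime_eq hβ l)]
    simp only [mul_add, ENNReal.tsum_add, mul_left_comm _ (catastropheTime c b h β 0),
      ENNReal.tsum_mul_left]
    rfl
  have hcancel : F * E + A * (ENNReal.ofReal β * E) = F * E + (1 + A) := by
    rw [← mul_assoc, mul_comm A, ← add_mul, hm.restartEmpty_add_mul_restartBusy hβ, hfirst]
    ring
  have hFE : F * E ≠ ∞ :=
    ENNReal.mul_ne_top (hm.restartEmpty_ne_top β) (hm.catastropheTime_ne_top hβ 0)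
  rw [ENNReal.eq_div_iff hA₀ hA |>.2 ((ENNReal.add_right_inj hFE).1 hcancel), ENNReal.add_div,
    ENNReal.div_self hA₀ hA, add_comm]

lemma IsModel.mul_catastropheTime (hm : IsModel c b h) (hβ : 0 < β) (j : ℕ) :
    ENNReal.ofReal β * catastropheTime c b h β j =
      1 + emptyProb c b β j / restartBusy c b h β := by
  rw [hm.catastropheTime_eq hβ, mul_add, ← mul_assoc, hm.mul_catastropheTime_zero hβ, add_mul,
    one_mul, ← add_assoc, add_comm (_ * _), hm.emptyProb_add_busyTime hβ, mul_comm, mul_one_div]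

lemma IsModel.mul_toReal_catastropheTime (hm : IsModel c b h) (hβ : 0 < β) (j : ℕ) :
    β * (catastropheTime c b h β j).toReal =
      1 + (emptyProb c b β j).toReal / (restartBusy c b h β).toReal := by
  have hdiv := (ENNReal.div_lt_top (emptyProb_ne_top (c := c) (b := b) β j)
    (hm.restartBusy_ne_zero β)).ne
  have hformula := congrArg ENNReal.toReal (hm.mul_catastropheTime hβ j)
  rwa [ENNReal.toReal_mul, ENNReal.toReal_ofReal hβ.le, ENNReal.toReal_add ENNReal.one_ne_top hdiv,
    ENNReal.toReal_one, ENNReal.toReal_div] at hformula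

lemma IsModel.mul_toReal_restartBusy (hm : IsModel c b h) (hβ : 0 < β) :
    β * (restartBusy c b h β).toReal = ∑' k, h k - (restartEmpty c b h β).toReal := by
  have hsum := congrArg ENNReal.toReal (hm.restartEmpty_add_mul_restartBusy hβ)
  rw [ENNReal.toReal_add (hm.restartEmpty_ne_top β) (ENNReal.mul_ne_top ENNReal.ofReal_ne_top
    (hm.restartBusy_ne_top hβ)), ENNReal.toReal_mul, ENNReal.toReal_ofReal hβ.le, restartTotal,
    ENNReal.toReal_ofReal hm.h_pos.le] at hsum
  exact eq_sub_of_add_eq' hsum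

lemma IsModel.toReal_catastropheTime_sub (hm : IsModel c b h) (hβ : 0 < β) (j : ℕ) :
    (catastropheTime c b h β j).toReal - 1 / β =
      (emptyProb c b β j).toReal / (∑' k, h k - (restartEmpty c b h β).toReal) := by
  rw [← hm.mul_toReal_restartBusy hβ, eq_div_of_mul_eq hβ.ne'
    ((mul_comm _ β).trans (hm.mul_toReal_catastropheTime hβ j)), ← sub_div, add_sub_cancel_left,
    div_div, mul_comm β]

end Formula

/-! ### The transient case -/

section Transient

variable {c : ℕ} {b h : ℕ → ℝ}

lemma IsModel.upTotal_nonneg (hm : IsModel c b h) : 0 ≤ -b 1 - b 0 :=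
  hm.hasSum_b_add_two.nonneg hm.b_add_two_nonneg

lemma IsModel.summable_b_mul_pow (hm : IsModel c b h) {s : ℝ} (hs₀ : 0 ≤ s) (hs₁ : s ≤ 1) :
    Summable fun j => b (j + 2) * s ^ (j + 2) :=
  hm.hasSum_b_add_two.summable.of_nonneg_of_le
    (fun j => mul_nonneg (hm.b_add_two_nonneg j) (pow_nonneg hs₀ _))
    (fun j => mul_le_of_le_one_right (hm.b_add_two_nonneg j) (pow_le_one₀ hs₀ hs₁))

lemma IsModel.Bi_eq (hm : IsModel c b h) {s : ℝ} (hs₀ : 0 ≤ s) (hs₁ : s ≤ 1) :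
    Bi b c s = c * b 0 * (1 - s) - (-b 1 - b 0) * s + ∑' j, b (j + 2) * s ^ (j + 2) := by
  have hsum : Summable fun j => b j * s ^ j :=
    (summable_nat_add_iff 2).1 (hm.summable_b_mul_pow hs₀ hs₁)
  rw [Bi, B, ← hsum.sum_add_tsum_nat_add 2]
  simp only [Finset.sum_range_succ, Finset.range_zero, Finset.sum_empty, pow_zero, pow_one]
  ring

lemma IsModel.Bi_one (hm : IsModel c b h) : Bi b c 1 = 0 := by
  rw [hm.Bi_eq zero_le_one le_rfl]
  simp only [one_pow, mul_one, hm.hasSum_b_add_two.tsum_eq]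
  ring

lemma IsModel.continuousOn_Bi (hm : IsModel c b h) : ContinuousOn (Bi b c) (Set.Icc 0 1) := by
  refine ContinuousOn.congr (f := fun s : ℝ => c * b 0 * (1 - s) - (-b 1 - b 0) * s +
    ∑' j, b (j + 2) * s ^ (j + 2)) ?_ fun s hs => hm.Bi_eq hs.1 hs.2
  refine ContinuousOn.add (by fun_prop) ?_
  refine continuousOn_tsum (fun j => by fun_prop) hm.hasSum_b_add_two.summable fun j s hs => ?_
  rw [Real.norm_of_nonneg (mul_nonneg (hm.b_add_two_nonneg j) (pow_nonneg hs.1 _))]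
  exact mul_le_of_le_one_right (hm.b_add_two_nonneg j) (pow_le_one₀ hs.1 hs.2)

lemma IsModel.smallestRoot_mem (hm : IsModel c b h) :
    0 ≤ smallestRoot c b ∧ smallestRoot c b ≤ 1 ∧ Bi b c (smallestRoot c b) = 0 := by
  have hroots : {s | 0 ≤ s ∧ s ≤ 1 ∧ Bi b c s = 0} = Set.Icc 0 1 ∩ Bi b c ⁻¹' {0} := by
    ext s
    simp [and_assoc]
  have hclosed : IsClosed {s | 0 ≤ s ∧ s ≤ 1 ∧ Bi b c s = 0} := by
    rw [hroots]
    exact hm.continuousOn_Bi.preimage_isClosed_of_isClosed isClosed_Icc isClosed_singleton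
  exact hclosed.csInf_mem ⟨1, zero_le_one, le_rfl, hm.Bi_one⟩ ⟨0, fun s hs => hs.1⟩

lemma IsModel.smallestRoot_le (hm : IsModel c b h) {s : ℝ} (hs₀ : 0 ≤ s) (hs₁ : s ≤ 1)
    (hs : Bi b c s ≤ 0) : smallestRoot c b ≤ s := by
  have hzero : 0 ≤ Bi b c 0 := by
    rw [hm.Bi_eq le_rfl zero_le_one]
    simpa using mul_nonneg (Nat.cast_nonneg c) hm.b_zero_pos.le
  obtain ⟨t, ht, ht_root⟩ := intermediate_value_Icc' hs₀
    (hm.continuousOn_Bi.mono (Set.Icc_subset_Icc_right hs₁)) ⟨hs, hzero⟩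
  have hle : smallestRoot c b ≤ t :=
    csInf_le ⟨0, fun s hs => hs.1⟩ ⟨ht.1, ht.2.trans hs₁, ht_root⟩
  exact hle.trans ht.2

lemma IsModel.exists_lt_sum_of_BiDerivOne_pos (hm : IsModel c b h) (hpos : 0 < BiDerivOne b c) :
    ∃ N, c * b 0 + (-b 1 - b 0) < ∑ j ∈ Finset.range N, ((j + 2 : ℕ) : ℝ) * b (j + 2) := by
  set v : ℝ := c * b 0 + (-b 1 - b 0) with hv
  have hv₀ : 0 ≤ v := add_nonneg (mul_nonneg (Nat.cast_nonneg c) hm.b_zero_pos.le)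
    hm.upTotal_nonneg
  have hlt : ENNReal.ofReal v < ∑' j : ℕ, ENNReal.ofReal (((j + 2 : ℕ) : ℝ) * b (j + 2)) := by
    refine lt_of_not_ge fun hle => hpos.not_ge ?_
    have hle' := EReal.coe_ennreal_le_coe_ennreal_iff.2 hle
    rw [EReal.coe_ennreal_ofReal, max_eq_left hv₀] at hle'
    calc BiDerivOne b c ≤ ((b 1 - ((c : ℝ) - 1) * b 0 : ℝ) : EReal) + (v : EReal) := by
          rw [BiDerivOne]; gcongr
      _ = 0 := by
          rw [← EReal.coe_add, hv, ← EReal.coe_zero]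
          congr 1
          ring
  rw [ENNReal.tsum_eq_iSup_nat, lt_iSup_iff] at hlt
  obtain ⟨N, hN⟩ := hlt
  rw [← ENNReal.ofReal_sum_of_nonneg fun j _ => mul_nonneg (Nat.cast_nonneg _)
    (hm.b_add_two_nonneg j)] at hN
  exact ⟨N, (ENNReal.ofReal_lt_ofReal_iff_of_nonneg hv₀).1 hN⟩

lemma IsModel.one_sub_mul_sum_geom_le (hm : IsModel c b h) {s : ℝ} (hs₀ : 0 ≤ s) (hs₁ : s ≤ 1)
    (N : ℕ) :
    (1 - s) * ∑ j ∈ Finset.range N, b (j + 2) * ∑ m ∈ Finset.range (j + 2), s ^ m ≤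
      (-b 1 - b 0) - ∑' j, b (j + 2) * s ^ (j + 2) := by
  have hsum := hm.hasSum_b_add_two.sub (hm.summable_b_mul_pow hs₀ hs₁).hasSum
  calc (1 - s) * ∑ j ∈ Finset.range N, b (j + 2) * ∑ m ∈ Finset.range (j + 2), s ^ m
      = ∑ j ∈ Finset.range N, (b (j + 2) - b (j + 2) * s ^ (j + 2)) := by
        rw [Finset.mul_sum]
        refine Finset.sum_congr rfl fun j _ => ?_
        rw [mul_left_comm, mul_neg_geom_sum, mul_sub, mul_one]
    _ ≤ _ := sum_le_hasSum _ (fun j _ => sub_nonneg.2 (mul_le_of_le_one_right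
        (hm.b_add_two_nonneg j) (pow_le_one₀ hs₀ hs₁))) hsum

lemma IsModel.exists_Bi_neg (hm : IsModel c b h) (hpos : 0 < BiDerivOne b c) :
    ∃ s : ℝ, 0 < s ∧ s < 1 ∧ Bi b c s < 0 := by
  obtain ⟨N, hN⟩ := hm.exists_lt_sum_of_BiDerivOne_pos hpos
  let g : ℝ → ℝ := fun s =>
    ∑ j ∈ Finset.range N, b (j + 2) * ∑ m ∈ Finset.range (j + 2), s ^ m
  have hg : Continuous g := by fun_prop
  have hg₁ : c * b 0 + (-b 1 - b 0) < g 1 := by simpa [g, mul_comm] using hN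
  have hnear : ∀ᶠ s in 𝓝[<] (1 : ℝ), c * b 0 + (-b 1 - b 0) < g s :=
    nhdsWithin_le_nhds (hg.tendsto 1 |>.eventually (lt_mem_nhds hg₁))
  obtain ⟨s, hs, hs₀, hs₁⟩ := (hnear.and (Ioo_mem_nhdsLT zero_lt_one)).exists
  refine ⟨s, hs₀, hs₁, ?_⟩
  have hgeom : (1 - s) * g s ≤ _ := hm.one_sub_mul_sum_geom_le hs₀.le hs₁.le N
  have hgap := mul_lt_mul_of_pos_left hs (sub_pos.2 hs₁)
  rw [hm.Bi_eq hs₀.le hs₁.le]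
  linarith

lemma IsModel.smallestRoot_lt_one (hm : IsModel c b h) (hpos : 0 < BiDerivOne b c) :
    smallestRoot c b < 1 := by
  obtain ⟨s, hs₀, hs₁, hs⟩ := hm.exists_Bi_neg hpos
  exact (hm.smallestRoot_le hs₀.le hs₁.le hs.le).trans_lt hs₁

/-- The function `i ↦ s ^ i` solves the system of equations with rates `killedRate c b 0` and
`jump c b` exactly for this source. If `s` is a root of `B_c`, the source lives in the states
`i < c`, where not all servers are busy. -/
def powSource (c : ℕ) (b : ℕ → ℝ) (s : ℝ) : ℕ → ℝ≥0∞
  | 0 => 1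
  | i + 1 => ENNReal.ofReal
      (s ^ i * (((c : ℝ) - (min (i + 1) c : ℕ)) * b 0 * (1 - s) - Bi b c s))

lemma IsModel.idle_mul_nonneg (hm : IsModel c b h) {s : ℝ} (hs₁ : s ≤ 1) (i : ℕ) :
    0 ≤ ((c : ℝ) - (min i c : ℕ)) * b 0 * (1 - s) :=
  mul_nonneg (mul_nonneg (sub_nonneg.2 (Nat.cast_le.2 (min_le_right _ _))) hm.b_zero_pos.le)
    (sub_nonneg.2 hs₁)

lemma IsModel.tsum_upRate_mul_pow (hm : IsModel c b h) {s : ℝ} (hs₀ : 0 ≤ s) (hs₁ : s ≤ 1)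
    (i : ℕ) :
    ∑' j, upRate b j * ENNReal.ofReal s ^ (j + (i + 2)) =
      ENNReal.ofReal (s ^ i * ∑' j, b (j + 2) * s ^ (j + 2)) := by
  rw [ENNReal.ofReal_mul (pow_nonneg hs₀ i), ENNReal.ofReal_tsum_of_nonneg
    (fun j => mul_nonneg (hm.b_add_two_nonneg j) (pow_nonneg hs₀ _))
    (hm.summable_b_mul_pow hs₀ hs₁), ← ENNReal.tsum_mul_left]
  refine tsum_congr fun j => ?_
  rw [ENNReal.ofReal_mul (hm.b_add_two_nonneg j), ENNReal.ofReal_pow hs₀,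
    ENNReal.ofReal_pow hs₀, upRate]
  ring

lemma IsModel.killedRate_mul_pow (hm : IsModel c b h) {s : ℝ} (hs₀ : 0 ≤ s) (hs₁ : s ≤ 1)
    (hs : Bi b c s ≤ 0) (i : ℕ) :
    killedRate c b 0 i * ENNReal.ofReal s ^ i =
      powSource c b s i + ∑' l, jump c b i l * ENNReal.ofReal s ^ l := by
  cases i with
  | zero => simp [powSource]
  | succ i =>
    have hup : 0 ≤ s ^ i * ∑' j, b (j + 2) * s ^ (j + 2) :=
      mul_nonneg (pow_nonneg hs₀ i)
        (tsum_nonneg fun j => mul_nonneg (hm.b_add_two_nonneg j) (pow_nonneg hs₀ _))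
    have hsource : 0 ≤ s ^ i * (((c : ℝ) - (min (i + 1) c : ℕ)) * b 0 * (1 - s) - Bi b c s) :=
      mul_nonneg (pow_nonneg hs₀ i) (by linarith [hm.idle_mul_nonneg hs₁ (i + 1)])
    have hdown : 0 ≤ ((min (i + 1) c : ℕ) : ℝ) * b 0 :=
      mul_nonneg (Nat.cast_nonneg _) hm.b_zero_pos.le
    rw [tsum_jump, hm.tsum_upRate_mul_pow hs₀ hs₁, killedRate_succ, ENNReal.ofReal_zero, add_zero,
      hm.upTotal_eq, downRate, powSource, ← ENNReal.ofReal_add hdown hm.upTotal_nonneg,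
      ← ENNReal.ofReal_pow hs₀, ← ENNReal.ofReal_pow hs₀,
      ← ENNReal.ofReal_mul (add_nonneg hdown hm.upTotal_nonneg), ← ENNReal.ofReal_mul hdown,
      ← ENNReal.ofReal_add (mul_nonneg hdown (pow_nonneg hs₀ i)) hup,
      ← ENNReal.ofReal_add hsource (add_nonneg (mul_nonneg hdown (pow_nonneg hs₀ i)) hup)]
    congr 1
    rw [hm.Bi_eq hs₀ hs₁]
    ring

lemma IsModel.minSol_powSource_le (hm : IsModel c b h) {s : ℝ} (hs₀ : 0 ≤ s) (hs₁ : s ≤ 1)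
    (hs : Bi b c s ≤ 0) (i : ℕ) :
    minSol (killedRate c b 0) (jump c b) (powSource c b s) i ≤ ENNReal.ofReal s ^ i :=
  minSol_le (fun i => (hm.killedRate_mul_pow hs₀ hs₁ hs i).ge) i

lemma IsModel.ofReal_neg_Bi_mul_pow_le (hm : IsModel c b h) {s : ℝ} (hs₀ : 0 ≤ s) (hs₁ : s ≤ 1)
    (hs : Bi b c s ≤ 0) (i : ℕ) :
    ENNReal.ofReal (-Bi b c s) * ENNReal.ofReal s ^ (i + 1) ≤ powSource c b s (i + 1) := by
  rw [powSource, ← ENNReal.ofReal_pow hs₀, ← ENNReal.ofReal_mul (neg_nonneg.2 hs)]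
  refine ENNReal.ofReal_le_ofReal ?_
  calc -Bi b c s * s ^ (i + 1) ≤ -Bi b c s * s ^ i :=
        mul_le_mul_of_nonneg_left (pow_le_pow_of_le_one hs₀ hs₁ i.le_succ) (neg_nonneg.2 hs)
    _ ≤ s ^ i * (((c : ℝ) - (min (i + 1) c : ℕ)) * b 0 * (1 - s) - Bi b c s) := by
        rw [mul_comm]
        exact mul_le_mul_of_nonneg_left (by linarith [hm.idle_mul_nonneg hs₁ (i + 1)])
          (pow_nonneg hs₀ i)

lemma IsModel.exists_pow_le_mul_minSol_powSource (hm : IsModel c b h) {s : ℝ} (hs₀ : 0 ≤ s)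
    (hs₁ : s ≤ 1) (hs : Bi b c s < 0) :
    ∃ C : ℝ≥0∞, C ≠ ∞ ∧ ∀ i, ENNReal.ofReal s ^ i ≤
      C * minSol (killedRate c b 0) (jump c b) (powSource c b s) i := by
  set ε := ENNReal.ofReal (-Bi b c s) with hε
  set R := ENNReal.ofReal (c * b 0) + upTotal b + ε
  have hε₀ : ε ≠ 0 := by simpa [hε] using hs
  have hR : R ≠ ∞ := ENNReal.add_ne_top.2
    ⟨ENNReal.add_ne_top.2 ⟨ENNReal.ofReal_ne_top, hm.upTotal_ne_top⟩, ENNReal.ofReal_ne_top⟩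
  have hsource : ∀ i, killedRate c b 0 i * (ε * ENNReal.ofReal s ^ i) ≤
      R * powSource c b s i := by
    rintro (_ | i)
    · simpa only [killedRate_zero, powSource, pow_zero, one_mul, mul_one] using
        (le_add_self : ε ≤ R)
    · gcongr
      · rw [killedRate_succ, ENNReal.ofReal_zero, add_zero]
        exact (add_le_add_left (hm.downRate_le _) _).trans le_self_add
      · exact hm.ofReal_neg_Bi_mul_pow_le hs₀ hs₁ hs.le i
  refine ⟨R / ε, (ENNReal.div_lt_top hR hε₀).ne, fun i => ?_⟩
  rw [ENNReal.mul_comm_div, mul_div_assoc', ENNReal.le_div_iff_mul_le (Or.inl hε₀)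
    (Or.inl ENNReal.ofReal_ne_top), mul_comm,
    ← ENNReal.mul_le_mul_iff_right (hm.killedRate_ne_zero 0 i) (hm.killedRate_ne_top 0 i)]
  calc _ ≤ R * powSource c b s i := hsource i
    _ ≤ R * (killedRate c b 0 i *
          minSol (killedRate c b 0) (jump c b) (powSource c b s) i) := by
        rw [mul_minSol (hm.killedRate_ne_zero 0) (hm.killedRate_ne_top 0)]
        gcongr
        exact le_self_add
    _ = _ := mul_left_comm _ _ _

lemma IsModel.smallestRoot_pow_eq_minSol (hm : IsModel c b h) (hpos : 0 < BiDerivOne b c)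
    (i : ℕ) :
    ENNReal.ofReal (smallestRoot c b) ^ i =
      minSol (killedRate c b 0) (jump c b) (powSource c b (smallestRoot c b)) i := by
  obtain ⟨hu₀, hu₁, hu⟩ := hm.smallestRoot_mem
  -- A point `s > u` with `B_c(s) < 0` makes `u ^ i ≤ s ^ i` smaller than a multiple of a finite
  -- minimal solution, which rules out that `u ^ i` exceeds the minimal solution for its source.
  obtain ⟨s, hs₀, hs₁, hs⟩ := hm.exists_Bi_neg hpos
  obtain ⟨C, hC, hsC⟩ := hm.exists_pow_le_mul_minSol_powSource hs₀.le hs₁.le hs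
  refine le_antisymm ?_ (hm.minSol_powSource_le hu₀ hu₁ hu.le i)
  refine le_minSol (x := fun i => ENNReal.ofReal (smallestRoot c b) ^ i)
    (hm.killedRate_ne_zero 0) (hm.killedRate_ne_top 0)
    (fun i => (hm.killedRate_mul_pow hu₀ hu₁ hu.le i).le) hC
    (fun i => le_trans ?_ (hsC i)) i ?_
  · gcongr
    exact hm.smallestRoot_le hs₀.le hs₁.le hs.le
  · exact ne_top_of_le_ne_top (ENNReal.pow_ne_top ENNReal.ofReal_ne_top)
      (hm.minSol_powSource_le hs₀.le hs₁.le hs.le i)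

lemma IsModel.toReal_powSource_smallestRoot (hm : IsModel c b h) {k : ℕ}
    (hk : k ∈ Finset.Ico 1 c) :
    (powSource c b (smallestRoot c b) k).toReal =
      smallestRoot c b ^ (k - 1) * ((c : ℝ) - k) * b 0 * (1 - smallestRoot c b) := by
  obtain ⟨hu₀, hu₁, hu⟩ := hm.smallestRoot_mem
  rw [Finset.mem_Ico] at hk
  obtain ⟨k, rfl⟩ := Nat.exists_eq_add_of_le' hk.1
  have hidle := hm.idle_mul_nonneg hu₁ (k + 1)
  rw [powSource, hu, sub_zero, ENNReal.toReal_ofReal (mul_nonneg (pow_nonneg hu₀ k) hidle),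
    min_eq_left hk.2.le, Nat.add_sub_cancel]
  ring

lemma powSource_ne_top (s : ℝ) (k : ℕ) : powSource c b s k ≠ ∞ := by
  cases k with
  | zero => exact ENNReal.one_ne_top
  | succ k => exact ENNReal.ofReal_ne_top

lemma tsum_eq_zero_add_sum_Ico (hc : 1 ≤ c) {f : ℕ → ℝ≥0∞} (hf : ∀ k, c ≤ k → f k = 0) :
    ∑' k, f k = f 0 + ∑ k ∈ Finset.Ico 1 c, f k := by
  rw [tsum_eq_sum (s := Finset.range c) fun k hk => hf k (by simpa using hk),
    Finset.range_eq_Ico, Finset.sum_eq_sum_Ico_succ_bot (by omega)]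

lemma IsModel.smallestRoot_pow_eq_add (hm : IsModel c b h) (hpos : 0 < BiDerivOne b c) (i : ℕ) :
    ENNReal.ofReal (smallestRoot c b) ^ i = emptyProb c b 0 i +
      ∑ k ∈ Finset.Ico 1 c, powSource c b (smallestRoot c b) k * green c b k i := by
  rw [hm.smallestRoot_pow_eq_minSol hpos, minSol_eq_tsum_single,
    tsum_eq_zero_add_sum_Ico hm.one_le_c fun k hk => ?_]
  · simp only [powSource, one_mul, emptyProb, green]
  · obtain ⟨k, rfl⟩ := Nat.exists_eq_add_of_le' (hm.one_le_c.trans hk)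
    simp [powSource, hm.smallestRoot_mem.2.2, min_eq_right hk]

lemma IsModel.summable_h_mul_pow (hm : IsModel c b h) {s : ℝ} (hs₀ : 0 ≤ s) (hs₁ : s ≤ 1) :
    Summable fun j => h j * s ^ j :=
  hm.h_summable.of_nonneg_of_le (fun j => mul_nonneg (hm.h_nonneg j) (pow_nonneg hs₀ _))
    (fun j => mul_le_of_le_one_right (hm.h_nonneg j) (pow_le_one₀ hs₀ hs₁))

lemma IsModel.ofReal_H_smallestRoot (hm : IsModel c b h) (hpos : 0 < BiDerivOne b c) :
    ENNReal.ofReal (H h (smallestRoot c b)) = restartEmpty c b h 0 +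
      ∑ k ∈ Finset.Ico 1 c, powSource c b (smallestRoot c b) k * r c b h k := by
  obtain ⟨hu₀, hu₁, -⟩ := hm.smallestRoot_mem
  calc ENNReal.ofReal (H h (smallestRoot c b))
      = ∑' j, ENNReal.ofReal (h j) * ENNReal.ofReal (smallestRoot c b) ^ j := by
        rw [H, ENNReal.ofReal_tsum_of_nonneg
          (fun j => mul_nonneg (hm.h_nonneg j) (pow_nonneg hu₀ _)) (hm.summable_h_mul_pow hu₀ hu₁)]
        simp only [ENNReal.ofReal_mul (hm.h_nonneg _), ENNReal.ofReal_pow hu₀]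
    _ = restartEmpty c b h 0 + ∑ k ∈ Finset.Ico 1 c, ∑' j,
          powSource c b (smallestRoot c b) k * (ENNReal.ofReal (h j) * green c b k j) := by
        simp only [hm.smallestRoot_pow_eq_add hpos, mul_add, Finset.mul_sum, mul_left_comm,
          ENNReal.tsum_add, restartEmpty, Summable.tsum_finsetSum fun _ _ => ENNReal.summable]
    _ = _ := by
        refine congrArg _ (Finset.sum_congr rfl fun k hk => ?_)
        rw [ENNReal.tsum_mul_left, hm.r_eq_tsum_green (by grind)]

lemma IsModel.transientDenom_eq (hm : IsModel c b h) (hpos : 0 < BiDerivOne b c) :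
    transientDenom c b h = ∑' k, h k - (restartEmpty c b h 0).toReal := by
  have hH : 0 ≤ H h (smallestRoot c b) :=
    tsum_nonneg fun j => mul_nonneg (hm.h_nonneg j) (pow_nonneg hm.smallestRoot_mem.1 _)
  have hfin : ∀ k ∈ Finset.Ico 1 c,
      powSource c b (smallestRoot c b) k * r c b h k ≠ ∞ := fun k hk =>
    ENNReal.mul_ne_top (powSource_ne_top _ k) (hm.r_ne_top (by grind))
  have hreal : H h (smallestRoot c b) = (restartEmpty c b h 0).toReal +
      ∑ k ∈ Finset.Ico 1 c,
        (powSource c b (smallestRoot c b) k).toReal * (r c b h k).toReal := by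
    rw [← ENNReal.toReal_ofReal hH, hm.ofReal_H_smallestRoot hpos,
      ENNReal.toReal_add (hm.restartEmpty_ne_top 0) (ENNReal.sum_ne_top.2 hfin),
      ENNReal.toReal_sum hfin]
    simp only [ENNReal.toReal_mul]
  rw [transientDenom, hreal, Finset.sum_congr rfl fun k hk =>
    congrArg (· * (r c b h k).toReal) (hm.toReal_powSource_smallestRoot hk)]
  ring

lemma IsModel.transientDenom_pos (hm : IsModel c b h) (hpos : 0 < BiDerivOne b c) :
    0 < transientDenom c b h := by
  obtain ⟨hu₀, hu₁, -⟩ := hm.smallestRoot_mem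
  have hH : H h (smallestRoot c b) < ∑' j, h j := by
    obtain ⟨l, hl, hl_pos⟩ := hm.exists_h_pos
    exact Summable.tsum_lt_tsum (i := l)
      (fun j => mul_le_of_le_one_right (hm.h_nonneg j) (pow_le_one₀ hu₀ hu₁))
      (mul_lt_of_lt_one_right hl_pos (pow_lt_one₀ hu₀ (hm.smallestRoot_lt_one hpos) hl))
      (hm.summable_h_mul_pow hu₀ hu₁) hm.h_summable
  refine add_pos_of_pos_of_nonneg (sub_pos.2 hH) (Finset.sum_nonneg fun k hk => ?_)
  rw [← hm.toReal_powSource_smallestRoot hk]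
  positivity

lemma IsModel.tendsto_toReal_emptyProb (hm : IsModel c b h) (j : ℕ) :
    Tendsto (fun β => (emptyProb c b β j).toReal) (𝓝[>] 0) (𝓝 (emptyProb c b 0 j).toReal) :=
  (ENNReal.tendsto_toReal (emptyProb_ne_top 0 j)).comp (hm.tendsto_minSol_killedRate _ j)

lemma IsModel.tendsto_catastropheTime_sub (hm : IsModel c b h) (hpos : 0 < BiDerivOne b c)
    (j : ℕ) :
    Tendsto (fun β => (catastropheTime c b h β j).toReal - 1 / β) (𝓝[>] 0)
      (𝓝 ((emptyProb c b 0 j).toReal / transientDenom c b h)) := by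
  have hrestart : Tendsto (fun β => (restartEmpty c b h β).toReal) (𝓝[>] 0)
      (𝓝 (restartEmpty c b h 0).toReal) :=
    (ENNReal.tendsto_toReal (hm.restartEmpty_ne_top 0)).comp
      (hm.tendsto_tsum_minSol_killedRate _ fun _ => ENNReal.ofReal_ne_top)
  have hlim := (hm.tendsto_toReal_emptyProb j).div (tendsto_const_nhds.sub hrestart)
    (hm.transientDenom_eq hpos ▸ (hm.transientDenom_pos hpos).ne')
  rw [← hm.transientDenom_eq hpos] at hlim
  refine hlim.congr' ?_
  filter_upwards [self_mem_nhdsWithin] with β hβ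
  exact (hm.toReal_catastropheTime_sub hβ j).symm

lemma IsModel.tendsto_catastropheTime_zero_sub (hm : IsModel c b h) (hpos : 0 < BiDerivOne b c) :
    Tendsto (fun β => (catastropheTime c b h β 0).toReal - 1 / β) (𝓝[>] 0)
      (𝓝 (1 / transientDenom c b h)) := by
  simpa only [hm.emptyProb_zero, ENNReal.toReal_one] using hm.tendsto_catastropheTime_sub hpos 0

lemma IsModel.tendsto_catastropheTime_sub_of_ne_zero (hm : IsModel c b h)
    (hpos : 0 < BiDerivOne b c) {j : ℕ} (hj : j ≠ 0) :
    Tendsto (fun β => (catastropheTime c b h β j).toReal - 1 / β) (𝓝[>] 0)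
      (𝓝 (b 0 * (mstar c b 1 j).toReal / transientDenom c b h)) := by
  have hlim := hm.tendsto_catastropheTime_sub hpos j
  rwa [hm.emptyProb_eq_mul_green_one hj, ← hm.mstar_eq_green one_ne_zero, ENNReal.toReal_mul,
    ENNReal.toReal_ofReal hm.b_zero_pos.le] at hlim

end Transient

/-! ### The positive recurrent case -/

section Recurrent

variable {c : ℕ} {b h : ℕ → ℝ}

lemma tsum_ne_top_of_BiDerivOne_neg (hneg : BiDerivOne b c < 0) :
    ∑' j : ℕ, ENNReal.ofReal (((j + 2 : ℕ) : ℝ) * b (j + 2)) ≠ ∞ := by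
  intro htop
  rw [BiDerivOne, htop, EReal.coe_ennreal_top, EReal.coe_add_top] at hneg
  exact not_top_lt hneg

lemma BiDerivOne_eq_coe (hneg : BiDerivOne b c < 0) :
    BiDerivOne b c = ((b 1 - ((c : ℝ) - 1) * b 0 +
      (∑' j : ℕ, ENNReal.ofReal (((j + 2 : ℕ) : ℝ) * b (j + 2))).toReal : ℝ) : EReal) := by
  rw [BiDerivOne, EReal.coe_add, EReal.coe_ennreal_toReal (tsum_ne_top_of_BiDerivOne_neg hneg)]

lemma neg_toReal_BiDerivOne_pos (hneg : BiDerivOne b c < 0) : 0 < -(BiDerivOne b c).toReal := by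
  have hcoe := hneg
  rw [BiDerivOne_eq_coe hneg, ← EReal.coe_zero, EReal.coe_lt_coe_iff] at hcoe
  rw [BiDerivOne_eq_coe hneg, EReal.toReal_coe]
  exact neg_pos.2 hcoe

/-- The rate at which the number of customers decreases on average while all servers are busy,
`-B_c'(1)`, if this is positive. -/
def drift (c : ℕ) (b : ℕ → ℝ) : ℝ≥0∞ := ENNReal.ofReal (-(BiDerivOne b c).toReal)

lemma drift_ne_zero (hneg : BiDerivOne b c < 0) : drift c b ≠ 0 := by
  simpa [drift] using neg_toReal_BiDerivOne_pos hneg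

lemma IsModel.drift_add_tsum (hm : IsModel c b h) (hneg : BiDerivOne b c < 0) :
    drift c b + ∑' j : ℕ, upRate b j * ((j : ℝ≥0∞) + 1) = ENNReal.ofReal (c * b 0) := by
  set S := ∑' j : ℕ, ENNReal.ofReal (((j + 2 : ℕ) : ℝ) * b (j + 2)) with hS
  have hS_top : S ≠ ∞ := tsum_ne_top_of_BiDerivOne_neg hneg
  have hS_eq : S = ∑' j : ℕ, upRate b j * ((j : ℝ≥0∞) + 1) + upTotal b := by
    rw [upTotal, ← ENNReal.tsum_add, hS]
    refine tsum_congr fun j => ?_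
    rw [ENNReal.ofReal_mul (Nat.cast_nonneg _), ENNReal.ofReal_natCast, upRate]
    push_cast
    ring
  have hadd : drift c b + S = ENNReal.ofReal (c * b 0) + upTotal b := by
    rw [drift, ← ENNReal.ofReal_toReal hS_top,
      ← ENNReal.ofReal_add (neg_toReal_BiDerivOne_pos hneg).le ENNReal.toReal_nonneg,
      hm.upTotal_eq, ← ENNReal.ofReal_add
      (mul_nonneg (Nat.cast_nonneg c) hm.b_zero_pos.le) hm.upTotal_nonneg,
      BiDerivOne_eq_coe hneg, EReal.toReal_coe]
    congr 1
    ring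
  rw [hS_eq, ← add_assoc] at hadd
  exact (ENNReal.add_left_inj hm.upTotal_ne_top).1 hadd

/-- The total rate at which the servers that are idle in state `i` would work. -/
def idleRate (c : ℕ) (b : ℕ → ℝ) (i : ℕ) : ℝ≥0∞ :=
  ENNReal.ofReal (((c : ℝ) - i) * b 0)

lemma IsModel.idleRate_eq_zero (hm : IsModel c b h) {i : ℕ} (hi : c ≤ i) :
    idleRate c b i = 0 :=
  ENNReal.ofReal_of_nonpos (mul_nonpos_of_nonpos_of_nonneg
    (sub_nonpos.2 (Nat.cast_le.2 hi)) hm.b_zero_pos.le)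

lemma IsModel.downRate_add_idleRate (hm : IsModel c b h) (i : ℕ) :
    downRate c b i + idleRate c b i = ENNReal.ofReal (c * b 0) := by
  rcases le_total i c with hi | hi
  · have hb := hm.b_zero_pos.le
    rw [downRate, idleRate, min_eq_left hi, ← ENNReal.ofReal_add (by positivity)
      (mul_nonneg (sub_nonneg.2 (Nat.cast_le.2 hi)) hb)]
    congr 1
    ring
  · rw [downRate, min_eq_right hi, hm.idleRate_eq_zero hi, add_zero]

lemma IsModel.killedRate_mul_natCast (hm : IsModel c b h) (hneg : BiDerivOne b c < 0) (i : ℕ) :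
    killedRate c b 0 i * (i : ℝ≥0∞) + idleRate c b i * busy i =
      drift c b * busy i + ∑' l, jump c b i l * (l : ℝ≥0∞) := by
  cases i with
  | zero => simp
  | succ i =>
    have hup : ∑' j, upRate b j * ((j + (i + 2) : ℕ) : ℝ≥0∞) =
        ∑' j : ℕ, upRate b j * ((j : ℝ≥0∞) + 1) + upTotal b * ((i : ℝ≥0∞) + 1) := by
      rw [upTotal, ← ENNReal.tsum_mul_right, ← ENNReal.tsum_add]
      refine tsum_congr fun j => ?_
      push_cast
      ring
    rw [tsum_jump, hup, killedRate_succ, ENNReal.ofReal_zero, add_zero, busy_succ, mul_one,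
      mul_one]
    calc (downRate c b (i + 1) + upTotal b) * ((i + 1 : ℕ) : ℝ≥0∞) + idleRate c b (i + 1)
        = (downRate c b (i + 1) + idleRate c b (i + 1)) + (downRate c b (i + 1) * i +
          upTotal b * ((i : ℝ≥0∞) + 1)) := by push_cast; ring
      _ = _ := by rw [hm.downRate_add_idleRate, ← hm.drift_add_tsum hneg]; ring

/-- The mean service capacity left idle in the states `i ≥ 1` until the queue is empty. -/
def idleWork (c : ℕ) (b : ℕ → ℝ) (i : ℕ) : ℝ≥0∞ :=
  minSol (killedRate c b 0) (jump c b) (fun k => idleRate c b k * busy k) i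

lemma IsModel.idleWork_eq_sum (hm : IsModel c b h) (i : ℕ) :
    idleWork c b i = ∑ k ∈ Finset.Ico 1 c, idleRate c b k * green c b k i := by
  rw [idleWork, minSol_eq_tsum_single, tsum_eq_zero_add_sum_Ico hm.one_le_c fun k hk => by
    rw [hm.idleRate_eq_zero hk, zero_mul, zero_mul], busy_zero, mul_zero, zero_mul, zero_add]
  refine Finset.sum_congr rfl fun k hk => ?_
  obtain ⟨k, rfl⟩ := Nat.exists_eq_add_of_le' (Finset.mem_Ico.1 hk).1
  rw [busy_succ, mul_one, green]

lemma IsModel.idleWork_ne_top (hm : IsModel c b h) (i : ℕ) : idleWork c b i ≠ ∞ := by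
  rw [hm.idleWork_eq_sum]
  exact ENNReal.sum_ne_top.2 fun k _ =>
    ENNReal.mul_ne_top ENNReal.ofReal_ne_top (hm.green_ne_top k i)

lemma IsModel.killedRate_mul_natCast_add_idleWork (hm : IsModel c b h)
    (hneg : BiDerivOne b c < 0) (i : ℕ) :
    killedRate c b 0 i * (i + idleWork c b i) =
      drift c b * busy i + ∑' l, jump c b i l * (l + idleWork c b l) := by
  simp only [mul_add, ENNReal.tsum_add, idleWork]
  rw [mul_minSol (hm.killedRate_ne_zero 0) (hm.killedRate_ne_top 0), ← add_assoc, ← add_assoc,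
    hm.killedRate_mul_natCast hneg]

-- Jumps lead down by one state only, so at least `n + 1` of them are needed from `i > n` to `0`.
lemma IsModel.inv_le_iterate_step_busy (hm : IsModel c b h) {n i : ℕ} (hni : n < i) :
    (ENNReal.ofReal (c * b 0) + upTotal b)⁻¹ ≤
      (step (killedRate c b 0) (jump c b))^[n] (busy / killedRate c b 0) i := by
  induction n generalizing i with
  | zero =>
    obtain ⟨i, rfl⟩ := Nat.exists_eq_add_of_le' hni
    rw [Function.iterate_zero_apply, Pi.div_apply, busy_succ, one_div, ENNReal.inv_le_inv,
      killedRate_succ, ENNReal.ofReal_zero, add_zero]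
    gcongr
    exact hm.downRate_le _
  | succ n ih =>
    obtain ⟨i, rfl⟩ := Nat.exists_eq_add_of_le' (Nat.one_le_of_lt hni)
    rw [Function.iterate_succ_apply', step, tsum_jump,
      ENNReal.le_div_iff_mul_le (Or.inl (hm.killedRate_ne_zero 0 _))
        (Or.inl (hm.killedRate_ne_top 0 _)), killedRate_succ, ENNReal.ofReal_zero, add_zero,
      mul_add, mul_comm, mul_comm _ (upTotal b), upTotal, ← ENNReal.tsum_mul_right]
    gcongr with j
    · exact ih (by omega)
    · exact ih (by omega)

lemma IsModel.natCast_le_mul_busyTime (hm : IsModel c b h) (i : ℕ) :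
    (i : ℝ≥0∞) ≤ (ENNReal.ofReal (c * b 0) + upTotal b) * busyTime c b 0 i := by
  set R := ENNReal.ofReal (c * b 0) + upTotal b
  have hR : R ≠ ∞ := ENNReal.add_ne_top.2 ⟨ENNReal.ofReal_ne_top, hm.upTotal_ne_top⟩
  have hR₀ : R ≠ 0 := ne_of_gt <| (pos_iff_ne_zero.2 hm.ofReal_b_zero_ne_zero).trans_le <|
    hm.downRate_one.symm.le.trans ((hm.downRate_le 1).trans le_self_add)
  have hsum : ∑ _n ∈ Finset.range i, R⁻¹ ≤ busyTime c b 0 i :=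
    (Finset.sum_le_sum fun n hn => hm.inv_le_iterate_step_busy (Finset.mem_range.1 hn)).trans
      (ENNReal.sum_le_tsum (Finset.range i))
  rw [Finset.sum_const, Finset.card_range, nsmul_eq_mul] at hsum
  calc (i : ℝ≥0∞) = R * (i * R⁻¹) := by
        rw [mul_left_comm, ENNReal.mul_inv_cancel hR₀ hR, mul_one]
    _ ≤ _ := by gcongr

lemma IsModel.idleWork_le_mul_busyTime (hm : IsModel c b h) (i : ℕ) :
    idleWork c b i ≤ ENNReal.ofReal (c * b 0) * busyTime c b 0 i := by
  rw [busyTime, ← minSol_const_mul]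
  refine minSol_mono (fun k => ?_) i
  gcongr
  exact hm.downRate_add_idleRate k ▸ le_add_self

lemma IsModel.drift_mul_busyTime_le (hm : IsModel c b h) (hneg : BiDerivOne b c < 0) (i : ℕ) :
    drift c b * busyTime c b 0 i ≤ i + idleWork c b i := by
  rw [busyTime, ← minSol_const_mul]
  exact minSol_le (fun i => (hm.killedRate_mul_natCast_add_idleWork hneg i).ge) i

lemma IsModel.busyTime_zero_left_ne_top (hm : IsModel c b h) (hneg : BiDerivOne b c < 0) (i : ℕ) :
    busyTime c b 0 i ≠ ∞ := fun htop => by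
  have hle := hm.drift_mul_busyTime_le hneg i
  rw [htop, ENNReal.mul_top (drift_ne_zero hneg), top_le_iff] at hle
  exact ENNReal.add_ne_top.2 ⟨ENNReal.natCast_ne_top i, hm.idleWork_ne_top i⟩ hle

lemma IsModel.drift_mul_busyTime (hm : IsModel c b h) (hneg : BiDerivOne b c < 0) (i : ℕ) :
    drift c b * busyTime c b 0 i = i + idleWork c b i := by
  refine le_antisymm (hm.drift_mul_busyTime_le hneg i) ?_
  rw [busyTime, ← minSol_const_mul]
  refine le_minSol (γ' := busy) (x := fun i : ℕ => (i : ℝ≥0∞) + idleWork c b i)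
    (C := (ENNReal.ofReal (c * b 0) + upTotal b) + ENNReal.ofReal (c * b 0))
    (hm.killedRate_ne_zero 0) (hm.killedRate_ne_top 0)
    (fun i => (hm.killedRate_mul_natCast_add_idleWork hneg i).le) ?_ (fun i => ?_) i
    (hm.busyTime_zero_left_ne_top hneg i)
  · exact ENNReal.add_ne_top.2 ⟨ENNReal.add_ne_top.2
      ⟨ENNReal.ofReal_ne_top, hm.upTotal_ne_top⟩, ENNReal.ofReal_ne_top⟩
  · rw [add_mul]
    exact add_le_add (hm.natCast_le_mul_busyTime i) (hm.idleWork_le_mul_busyTime i)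

lemma IsModel.drift_mul_restartBusy (hm : IsModel c b h) (hneg : BiDerivOne b c < 0) :
    drift c b * restartBusy c b h 0 =
      mu1 h + ∑ k ∈ Finset.Ico 1 c, idleRate c b k * r c b h k := by
  calc drift c b * restartBusy c b h 0
      = ∑' l, ENNReal.ofReal (h l) * (l + idleWork c b l) := by
        simp only [restartBusy, ← ENNReal.tsum_mul_left, mul_left_comm (drift c b),
          hm.drift_mul_busyTime hneg]
    _ = mu1 h + ∑ k ∈ Finset.Ico 1 c,
          ∑' l, idleRate c b k * (ENNReal.ofReal (h l) * green c b k l) := by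
        simp only [hm.idleWork_eq_sum, mul_add, Finset.mul_sum, ENNReal.tsum_add, mu1,
          ENNReal.ofReal_mul (Nat.cast_nonneg _), ENNReal.ofReal_natCast,
          mul_left_comm (idleRate c b _), Summable.tsum_finsetSum fun _ _ => ENNReal.summable]
        simp only [mul_comm]
    _ = _ := by
        refine congrArg _ (Finset.sum_congr rfl fun k hk => ?_)
        rw [ENNReal.tsum_mul_left, hm.r_eq_tsum_green (by grind)]

lemma IsModel.idleRate_mul_r_ne_top (hm : IsModel c b h) {k : ℕ} (hk : k ∈ Finset.Ico 1 c) :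
    idleRate c b k * r c b h k ≠ ∞ :=
  ENNReal.mul_ne_top ENNReal.ofReal_ne_top (hm.r_ne_top (by grind))

lemma IsModel.toReal_sum_idleRate_mul_r (hm : IsModel c b h) :
    (∑ k ∈ Finset.Ico 1 c, idleRate c b k * r c b h k).toReal = rSum c b h := by
  rw [ENNReal.toReal_sum fun k => hm.idleRate_mul_r_ne_top, rSum]
  refine Finset.sum_congr rfl fun k hk => ?_
  have hkc : (k : ℝ) ≤ c := Nat.cast_le.2 (Finset.mem_Ico.1 hk).2.le
  rw [ENNReal.toReal_mul, idleRate, ENNReal.toReal_ofReal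
    (mul_nonneg (sub_nonneg.2 hkc) hm.b_zero_pos.le)]
  ring

lemma IsModel.restartBusy_zero_left_ne_top (hm : IsModel c b h) (hneg : BiDerivOne b c < 0)
    (hmu : mu1 h < ∞) : restartBusy c b h 0 ≠ ∞ := by
  intro htop
  have heq := hm.drift_mul_restartBusy hneg
  rw [htop, ENNReal.mul_top (drift_ne_zero hneg)] at heq
  exact ENNReal.add_ne_top.2
    ⟨hmu.ne, ENNReal.sum_ne_top.2 fun k => hm.idleRate_mul_r_ne_top⟩ heq.symm

lemma IsModel.neg_toReal_BiDerivOne_mul_toReal_restartBusy (hm : IsModel c b h)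
    (hneg : BiDerivOne b c < 0) (hmu : mu1 h < ∞) :
    -(BiDerivOne b c).toReal * (restartBusy c b h 0).toReal = (mu1 h).toReal + rSum c b h := by
  rw [← hm.toReal_sum_idleRate_mul_r, ← ENNReal.toReal_add hmu.ne
    (ENNReal.sum_ne_top.2 fun k => hm.idleRate_mul_r_ne_top), ← hm.drift_mul_restartBusy hneg,
    drift, ENNReal.toReal_mul, ENNReal.toReal_ofReal (neg_toReal_BiDerivOne_pos hneg).le]

lemma IsModel.emptyProb_zero_left (hm : IsModel c b h) (hneg : BiDerivOne b c < 0) (i : ℕ) :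
    emptyProb c b 0 i = 1 := by
  have hlim : Tendsto (fun β => emptyProb c b β i + ENNReal.ofReal β * busyTime c b β i) (𝓝[>] 0)
      (𝓝 (emptyProb c b 0 i + ENNReal.ofReal 0 * busyTime c b 0 i)) :=
    (hm.tendsto_minSol_killedRate _ i).add (ENNReal.Tendsto.mul
      ((ENNReal.continuous_ofReal.tendsto 0).mono_left nhdsWithin_le_nhds)
      (Or.inr (hm.busyTime_zero_left_ne_top hneg i))
      (hm.tendsto_minSol_killedRate _ i) (Or.inr ENNReal.ofReal_ne_top))
  rw [ENNReal.ofReal_zero, zero_mul, add_zero] at hlim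
  refine tendsto_nhds_unique hlim (tendsto_const_nhds.congr' ?_)
  filter_upwards [self_mem_nhdsWithin] with β hβ
  exact (hm.emptyProb_add_busyTime hβ i).symm

lemma IsModel.toReal_restartBusy_zero_left_pos (hm : IsModel c b h) (hneg : BiDerivOne b c < 0)
    (hmu : mu1 h < ∞) : 0 < (restartBusy c b h 0).toReal :=
  ENNReal.toReal_pos (hm.restartBusy_ne_zero 0) (hm.restartBusy_zero_left_ne_top hneg hmu)

lemma IsModel.tendsto_mul_catastropheTime (hm : IsModel c b h) (hneg : BiDerivOne b c < 0)
    (hmu : mu1 h < ∞) (j : ℕ) :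
    Tendsto (fun β => β * (catastropheTime c b h β j).toReal) (𝓝[>] 0)
      (𝓝 (1 + 1 / (restartBusy c b h 0).toReal)) := by
  have hbusy : Tendsto (fun β => (restartBusy c b h β).toReal) (𝓝[>] 0)
      (𝓝 (restartBusy c b h 0).toReal) :=
    (ENNReal.tendsto_toReal (hm.restartBusy_zero_left_ne_top hneg hmu)).comp
      (hm.tendsto_tsum_minSol_killedRate _ fun _ => ENNReal.ofReal_ne_top)
  have hlim := ((hm.tendsto_toReal_emptyProb j).div hbusy
    (hm.toReal_restartBusy_zero_left_pos hneg hmu).ne').const_add 1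
  rw [hm.emptyProb_zero_left hneg, ENNReal.toReal_one] at hlim
  refine hlim.congr' ?_
  filter_upwards [self_mem_nhdsWithin] with β hβ
  exact (hm.mul_toReal_catastropheTime hβ j).symm

lemma IsModel.tendsto_mul_catastropheTime_drift (hm : IsModel c b h) (hneg : BiDerivOne b c < 0)
    (hmu : mu1 h < ∞) (j : ℕ) :
    Tendsto (fun β => β * (catastropheTime c b h β j).toReal) (𝓝[>] 0)
      (𝓝 ((-(BiDerivOne b c).toReal + (mu1 h).toReal + rSum c b h) /
        ((mu1 h).toReal + rSum c b h))) := by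
  have hdrift := neg_toReal_BiDerivOne_pos hneg
  have hbusy := hm.toReal_restartBusy_zero_left_pos hneg hmu
  convert hm.tendsto_mul_catastropheTime hneg hmu j using 2
  rw [add_assoc, ← hm.neg_toReal_BiDerivOne_mul_toReal_restartBusy hneg hmu,
    ← mul_one_add, mul_div_mul_left _ _ hdrift.ne', add_div, div_self hbusy.ne', add_comm]

end Recurrent

/-! ### Equilibrium distributions -/

section Equilibrium

lemma hasSum_iff_tsum_ofReal {ι : Type*} {g : ι → ℝ} {v : ℝ} (hg : ∀ i, 0 ≤ g i) (hv : 0 ≤ v) :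
    HasSum g v ↔ ∑' i, ENNReal.ofReal (g i) = ENNReal.ofReal v := by
  refine ⟨fun hsum => ?_, fun hsum => ?_⟩
  · rw [← hsum.tsum_eq, ENNReal.ofReal_tsum_of_nonneg hg hsum.summable]
  · have htoReal := ENNReal.hasSum_toReal (hsum.trans_ne ENNReal.ofReal_ne_top)
    rw [← ENNReal.tsum_toReal_eq fun _ => ENNReal.ofReal_ne_top, hsum,
      ENNReal.toReal_ofReal hv] at htoReal
    simpa only [ENNReal.toReal_ofReal (hg _)] using htoReal

lemma hasSum_balance_iff {S : Type*} [DecidableEq S] {Q : S → S → ℝ} {π : S → ℝ} {j : S}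
    (hπ : ∀ i, 0 ≤ π i) (hQ : ∀ i, i ≠ j → 0 ≤ Q i j) (hQj : Q j j ≤ 0) :
    HasSum (fun i => π i * Q i j) 0 ↔
      ∑' i, offDiag Q i j * ENNReal.ofReal (π i) =
        ENNReal.ofReal (-Q j j) * ENNReal.ofReal (π j) := by
  set inflow := Function.update (fun i => π i * Q i j) j 0
  have hinflow₀ : ∀ i, 0 ≤ inflow i := fun i => by
    rcases eq_or_ne i j with rfl | hi
    · simp [inflow]
    · simpa [inflow, hi] using mul_nonneg (hπ i) (hQ i hi)
  have hinflow : ∀ i, ENNReal.ofReal (inflow i) = offDiag Q i j * ENNReal.ofReal (π i) :=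
    fun i => by
      rcases eq_or_ne i j with rfl | hi
      · simp [inflow, offDiag]
      · simp [inflow, offDiag, hi, hi.symm, ENNReal.ofReal_mul (hπ i),
          mul_comm (ENNReal.ofReal (Q i j))]
  have hmove : HasSum (fun i => π i * Q i j) 0 ↔ HasSum inflow (-Q j j * π j) := by
    refine ⟨fun hsum => ?_, fun hsum => ?_⟩
    · simpa [inflow, mul_comm (Q j j)] using hsum.update j 0
    · simpa [inflow, mul_comm] using hsum.update j (π j * Q j j)
  rw [hmove, hasSum_iff_tsum_ofReal hinflow₀ (mul_nonneg (neg_nonneg.2 hQj) (hπ j)),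
    ENNReal.ofReal_mul (neg_nonneg.2 hQj)]
  simp only [hinflow]

/-- The exit rates of the queue with restarts and without catastrophes. -/
def restartRate (c : ℕ) (b h : ℕ → ℝ) (j : ℕ) : ℝ≥0∞ :=
  if j = 0 then restartTotal h else killedRate c b 0 j

/-- Invariance of a measure `p` on the state space of the queue with restarts, as the balance of
the flows into and out of each state; `p` may be infinite. -/
def IsInvariant (c : ℕ) (b h : ℕ → ℝ) (p : ℕ → ℝ≥0∞) : Prop :=
  ∀ j, ENNReal.ofReal (h j) * p 0 + ∑' i, jump c b i j * p i = restartRate c b h j * p j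

variable {c : ℕ} {b h : ℕ → ℝ} {β : ℝ} {p : ℕ → ℝ≥0∞} {π : ℕ → ℝ}

@[simp] lemma restartRate_zero : restartRate c b h 0 = restartTotal h := rfl

@[simp] lemma restartRate_succ (j : ℕ) :
    restartRate c b h (j + 1) = killedRate c b 0 (j + 1) := rfl

lemma IsModel.ofReal_neg_Qtilde (hm : IsModel c b h) (j : ℕ) :
    ENNReal.ofReal (-Qtilde c b h j j) = restartRate c b h j := by
  rcases eq_or_ne j 0 with rfl | hj
  · simp [Qtilde, Qs, Qstar, restartTotal]
  · rw [restartRate, if_neg hj, killedRate_zero_left, ← hm.exitRate_Qstar, exitRate, if_neg hj]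
    simp [Qtilde, Qs, hj]

lemma IsModel.Qtilde_self_nonpos (hm : IsModel c b h) (j : ℕ) : Qtilde c b h j j ≤ 0 := by
  rcases eq_or_ne j 0 with rfl | hj
  · simpa [Qtilde, Qs, Qstar] using hm.h_pos.le
  · simpa [Qtilde, Qs, hj] using (hm.Qstar_self_neg hj).le

lemma IsModel.Qtilde_nonneg (hm : IsModel c b h) {i j : ℕ} (hij : i ≠ j) :
    0 ≤ Qtilde c b h i j := by
  refine add_nonneg ?_ ?_
  · unfold Qstar
    split_ifs with _ _ hji
    · exact le_rfl
    · exact mul_nonneg (Nat.cast_nonneg _) hm.b_zero_pos.le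
    · exact absurd hji.symm hij
    · exact hm.b_nonneg _ (by omega)
    · exact le_rfl
  · unfold Qs
    split_ifs with hi hj
    · exact absurd (hi.trans hj.symm) hij
    · exact hm.h_nonneg j
    · exact le_rfl

lemma IsModel.offDiag_Qtilde_zero (hm : IsModel c b h) (j : ℕ) :
    offDiag (Qtilde c b h) 0 j = ENNReal.ofReal (h j) := by
  rcases eq_or_ne j 0 with rfl | hj
  · simp [offDiag, hm.h_zero]
  · simp [offDiag, hj, Qtilde, Qstar, Qs]

lemma offDiag_Qtilde_succ (i j : ℕ) :
    offDiag (Qtilde c b h) (i + 1) j = jump c b (i + 1) j := by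
  simp [offDiag, jump, Qtilde, Qs]

lemma IsModel.tsum_offDiag_Qtilde (hm : IsModel c b h) (x : ℕ → ℝ≥0∞) (j : ℕ) :
    ∑' i, offDiag (Qtilde c b h) i j * x i =
      ENNReal.ofReal (h j) * x 0 + ∑' i, jump c b i j * x i := by
  rw [tsum_eq_zero_add' ENNReal.summable,
    tsum_eq_zero_add' (f := fun i => jump c b i j * x i) ENNReal.summable, jump_zero, zero_mul,
    zero_add, hm.offDiag_Qtilde_zero]
  simp only [offDiag_Qtilde_succ]

lemma IsModel.isEquilibrium_iff (hm : IsModel c b h) (hπ : ∀ i, 0 ≤ π i) :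
    IsEquilibrium (Qtilde c b h) π ↔
      ∑' i, ENNReal.ofReal (π i) = 1 ∧ IsInvariant c b h fun i => ENNReal.ofReal (π i) := by
  have hbalance : ∀ j, HasSum (fun i => π i * Qtilde c b h i j) 0 ↔
      ENNReal.ofReal (h j) * ENNReal.ofReal (π 0) + ∑' i, jump c b i j * ENNReal.ofReal (π i) =
        restartRate c b h j * ENNReal.ofReal (π j) := fun j => by
    rw [hasSum_balance_iff hπ (fun i hi => hm.Qtilde_nonneg hi) (hm.Qtilde_self_nonpos j),
      hm.ofReal_neg_Qtilde, hm.tsum_offDiag_Qtilde fun i => ENNReal.ofReal (π i)]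
  have hone := hasSum_iff_tsum_ofReal hπ zero_le_one
  rw [ENNReal.ofReal_one] at hone
  exact ⟨fun hequ => ⟨hone.1 hequ.hasSum_one, fun j => (hbalance j).1 (hequ.balance j)⟩,
    fun ⟨hsum, hinv⟩ => ⟨hπ, hone.2 hsum, fun j => (hbalance j).2 (hinv j)⟩⟩

lemma IsModel.restartRate_le (hm : IsModel c b h) (j : ℕ) :
    restartRate c b h j ≤ restartTotal h + (ENNReal.ofReal (c * b 0) + upTotal b) := by
  rcases j with _ | j
  · exact le_self_add
  · rw [restartRate_succ, killedRate_succ, ENNReal.ofReal_zero, add_zero]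
    exact (add_le_add_left (hm.downRate_le _) _).trans le_add_self

lemma IsInvariant.tsum_mul (hp : IsInvariant c b h p) (f : ℕ → ℝ≥0∞) :
    ∑' j, p j * (restartRate c b h j * f j) =
      p 0 * ∑' j, ENNReal.ofReal (h j) * f j + ∑' i, p i * ∑' j, jump c b i j * f j := by
  calc ∑' j, p j * (restartRate c b h j * f j)
      = ∑' j, (p 0 * (ENNReal.ofReal (h j) * f j) + ∑' i, p i * (jump c b i j * f j)) := by
        refine tsum_congr fun j => ?_
        rw [← mul_assoc, mul_comm (p j), ← hp j, add_mul, ← ENNReal.tsum_mul_right]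
        congr 1
        · ring
        · exact tsum_congr fun i => by ring
    _ = p 0 * ∑' j, ENNReal.ofReal (h j) * f j + ∑' i, p i * ∑' j, jump c b i j * f j := by
        rw [ENNReal.tsum_add, ENNReal.tsum_mul_left, ENNReal.tsum_comm]
        simp only [ENNReal.tsum_mul_left]

lemma IsModel.restartRate_mul_emptyProb_add (hm : IsModel c b h) (β : ℝ) (j : ℕ) :
    restartRate c b h j * emptyProb c b β j + ENNReal.ofReal β * (busy j * emptyProb c b β j) =
      (Pi.single 0 (restartTotal h) : ℕ → ℝ≥0∞) j + ∑' l, jump c b j l * emptyProb c b β l := by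
  rcases j with _ | j
  · simp [hm.emptyProb_zero]
  · have hfirst := hm.killedRate_mul_emptyProb β (j + 1)
    rw [killedRate_succ, add_mul] at hfirst
    simpa [killedRate_succ] using hfirst

lemma IsModel.tsum_mul_restartRate_mul_emptyProb_ne_top (hm : IsModel c b h)
    (hfin : ∑' i, p i ≠ ∞) (β : ℝ) :
    ∑' j, p j * (restartRate c b h j * emptyProb c b β j) ≠ ∞ := by
  set R := restartTotal h + (ENNReal.ofReal (c * b 0) + upTotal b)
  have hR : R ≠ ∞ := ENNReal.add_ne_top.2 ⟨restartTotal_ne_top,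
    ENNReal.add_ne_top.2 ⟨ENNReal.ofReal_ne_top, hm.upTotal_ne_top⟩⟩
  refine ne_top_of_le_ne_top (ENNReal.mul_ne_top hfin hR) ?_
  rw [← ENNReal.tsum_mul_right]
  gcongr with j
  exact (mul_le_of_le_one_right' (emptyProb_le_one β j)).trans (hm.restartRate_le j)

lemma IsModel.mul_restartBusy_of_isInvariant (hm : IsModel c b h) (hp : IsInvariant c b h p)
    (hfin : ∑' i, p i ≠ ∞) (hβ : 0 < β) :
    p 0 * restartBusy c b h β = ∑' i, p i * (busy i * emptyProb c b β i) := by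
  set e := emptyProb c b β
  set lhs := ∑' j, p j * (restartRate c b h j * e j)
  have hlhs : lhs ≠ ∞ := hm.tsum_mul_restartRate_mul_emptyProb_ne_top hfin β
  have hinv : lhs = p 0 * restartEmpty c b h β + ∑' i, p i * ∑' j, jump c b i j * e j :=
    hp.tsum_mul e
  have hfirst : lhs + ENNReal.ofReal β * ∑' i, p i * (busy i * e i) =
      p 0 * restartTotal h + ∑' i, p i * ∑' j, jump c b i j * e j := by
    have hzero : ∑' i, p i * (Pi.single 0 (restartTotal h) : ℕ → ℝ≥0∞) i =
        p 0 * restartTotal h := by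
      rw [tsum_eq_single 0 fun i hi => by simp [hi], Pi.single_eq_same]
    rw [← hzero, ← ENNReal.tsum_add, ← ENNReal.tsum_mul_left, ← ENNReal.tsum_add]
    refine tsum_congr fun i => ?_
    rw [← mul_add, ← hm.restartRate_mul_emptyProb_add β i]
    ring
  have hcancel : lhs + ENNReal.ofReal β * (p 0 * restartBusy c b h β) =
      lhs + ENNReal.ofReal β * ∑' i, p i * (busy i * e i) := by
    rw [hfirst, hinv, ← hm.restartEmpty_add_mul_restartBusy hβ]
    ring
  exact (ENNReal.mul_right_inj (by simpa using hβ) ENNReal.ofReal_ne_top).1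
    ((ENNReal.add_right_inj hlhs).1 hcancel)

lemma IsModel.mul_restartBusy_zero_left_of_isInvariant (hm : IsModel c b h)
    (hneg : BiDerivOne b c < 0) (hp : IsInvariant c b h p) (hfin : ∑' i, p i ≠ ∞) :
    p 0 * restartBusy c b h 0 = ∑' i, p i * busy i := by
  have hp_ne_top : ∀ i, p i ≠ ∞ := ENNReal.ne_top_of_tsum_ne_top hfin
  have hbusy : Tendsto (fun β => p 0 * restartBusy c b h β) (𝓝[>] 0)
      (𝓝 (p 0 * restartBusy c b h 0)) :=
    ENNReal.Tendsto.const_mul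
      (hm.tendsto_tsum_minSol_killedRate _ fun _ => ENNReal.ofReal_ne_top)
      (Or.inr (hp_ne_top 0))
  have hempty : Tendsto (fun β => ∑' i, p i * busy i * emptyProb c b β i) (𝓝[>] 0)
      (𝓝 (∑' i, p i * busy i * emptyProb c b 0 i)) :=
    hm.tendsto_tsum_minSol_killedRate _ fun i => ENNReal.mul_ne_top (hp_ne_top i) (busy_ne_top i)
  simp only [hm.emptyProb_zero_left hneg, mul_one] at hempty
  refine tendsto_nhds_unique hbusy (hempty.congr' ?_)
  filter_upwards [self_mem_nhdsWithin] with β hβ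
  simpa only [mul_assoc] using (hm.mul_restartBusy_of_isInvariant hp hfin hβ).symm

lemma IsModel.mul_one_add_restartBusy (hm : IsModel c b h) (hneg : BiDerivOne b c < 0)
    (hp : IsInvariant c b h p) (hfin : ∑' i, p i ≠ ∞) :
    p 0 * (1 + restartBusy c b h 0) = ∑' i, p i := by
  rw [mul_add, mul_one, hm.mul_restartBusy_zero_left_of_isInvariant hneg hp hfin,
    tsum_eq_zero_add' (f := p) ENNReal.summable, tsum_eq_zero_add' ENNReal.summable]
  simp

lemma IsModel.equilibrium_zero (hm : IsModel c b h) (hneg : BiDerivOne b c < 0)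
    (hmu : mu1 h < ∞) (hπ : IsEquilibrium (Qtilde c b h) π) :
    π 0 * (1 + (restartBusy c b h 0).toReal) = 1 := by
  obtain ⟨hsum, hinv⟩ := (hm.isEquilibrium_iff hπ.nonneg).1 hπ
  have hone := hm.mul_one_add_restartBusy hneg hinv (hsum.trans_ne ENNReal.one_ne_top)
  have htoReal := congrArg ENNReal.toReal (hone.trans hsum)
  rwa [ENNReal.toReal_mul, ENNReal.toReal_ofReal (hπ.nonneg 0),
    ENNReal.toReal_add ENNReal.one_ne_top (hm.restartBusy_zero_left_ne_top hneg hmu),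
    ENNReal.toReal_one] at htoReal

lemma IsModel.equilibrium_zero_lt_one (hm : IsModel c b h) (hneg : BiDerivOne b c < 0)
    (hmu : mu1 h < ∞) (hπ : IsEquilibrium (Qtilde c b h) π) : π 0 < 1 := by
  have hbusy := hm.toReal_restartBusy_zero_left_pos hneg hmu
  rw [eq_one_div_of_mul_eq_one_left (hm.equilibrium_zero hneg hmu hπ), div_lt_one (by positivity)]
  exact lt_add_of_pos_right 1 hbusy

lemma IsModel.tendsto_mul_catastropheTime_equilibrium (hm : IsModel c b h)
    (hneg : BiDerivOne b c < 0) (hmu : mu1 h < ∞) (hπ : IsEquilibrium (Qtilde c b h) π) (j : ℕ) :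
    Tendsto (fun β => β * (catastropheTime c b h β j).toReal) (𝓝[>] 0)
      (𝓝 (1 / (1 - π 0))) := by
  have hbusy := hm.toReal_restartBusy_zero_left_pos hneg hmu
  convert hm.tendsto_mul_catastropheTime hneg hmu j using 2
  rw [eq_one_div_of_mul_eq_one_left (hm.equilibrium_zero hneg hmu hπ)]
  field_simp [hbusy.ne']
  rw [add_sub_cancel_left]
  ring

/-- The invariant measure of the queue with restarts which has the weight `1` at `0`. -/
def invariantMeasure (c : ℕ) (b h : ℕ → ℝ) (j : ℕ) : ℝ≥0∞ :=
  if j = 0 then 1 else r c b h j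

@[simp] lemma invariantMeasure_zero : invariantMeasure c b h 0 = 1 := rfl

lemma IsModel.invariantMeasure_of_ne_zero (hm : IsModel c b h) {j : ℕ} (hj : j ≠ 0) :
    invariantMeasure c b h j = ∑' l, ENNReal.ofReal (h l) * green c b j l := by
  rw [invariantMeasure, if_neg hj, hm.r_eq_tsum_green hj]

lemma IsModel.tsum_invariantMeasure (hm : IsModel c b h) :
    ∑' j, invariantMeasure c b h j = 1 + restartBusy c b h 0 := by
  have hbusy : ∀ l, busyTime c b 0 l = ∑' j, green c b (j + 1) l := fun l => by
    rw [busyTime, minSol_eq_tsum_single, tsum_eq_zero_add' ENNReal.summable]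
    simp [green]
  rw [tsum_eq_zero_add' ENNReal.summable, invariantMeasure_zero, restartBusy]
  simp only [hbusy, hm.invariantMeasure_of_ne_zero (Nat.succ_ne_zero _), ← ENNReal.tsum_mul_left]
  rw [ENNReal.tsum_comm]

lemma IsModel.tsum_jump_mul_invariantMeasure (hm : IsModel c b h) (j : ℕ) :
    ∑' i, jump c b i j * invariantMeasure c b h i =
      ∑' l, ENNReal.ofReal (h l) * ∑' i, jump c b i j * green c b i l := by
  simp only [← ENNReal.tsum_mul_left]
  rw [ENNReal.tsum_comm]
  refine tsum_congr fun i => ?_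
  rcases eq_or_ne i 0 with rfl | hi
  · simp
  · rw [hm.invariantMeasure_of_ne_zero hi, ← ENNReal.tsum_mul_left]
    exact tsum_congr fun l => mul_left_comm _ _ _

lemma IsModel.restartRate_mul_invariantMeasure (hm : IsModel c b h) (hneg : BiDerivOne b c < 0)
    (j : ℕ) :
    restartRate c b h j * invariantMeasure c b h j =
      ∑' l, ENNReal.ofReal (h l) * (killedRate c b 0 j * green c b j l) := by
  rcases j with _ | j
  · simp [green_zero, hm.emptyProb_zero_left hneg, hm.tsum_restart]
  · rw [restartRate_succ, hm.invariantMeasure_of_ne_zero (Nat.succ_ne_zero j),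
      ← ENNReal.tsum_mul_left]
    exact tsum_congr fun l => mul_left_comm _ _ _

lemma IsModel.isInvariant_invariantMeasure (hm : IsModel c b h) (hneg : BiDerivOne b c < 0) :
    IsInvariant c b h (invariantMeasure c b h) := fun j => by
  have hsingle : ∑' l, ENNReal.ofReal (h l) * (Pi.single j 1 : ℕ → ℝ≥0∞) l =
      ENNReal.ofReal (h j) := by
    rw [tsum_eq_single j fun l hl => by simp [hl], Pi.single_eq_same, mul_one]
  simp only [hm.restartRate_mul_invariantMeasure hneg, hm.killedRate_mul_green, mul_add]
  rw [ENNReal.tsum_add, hsingle, hm.tsum_jump_mul_invariantMeasure, invariantMeasure_zero, mul_one]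

lemma IsInvariant.const_mul (hp : IsInvariant c b h p) (a : ℝ≥0∞) :
    IsInvariant c b h fun i => a * p i := fun j => by
  simp only [mul_left_comm _ a, ENNReal.tsum_mul_left, ← mul_add, hp j]

lemma IsModel.exists_isEquilibrium (hm : IsModel c b h) (hneg : BiDerivOne b c < 0)
    (hmu : mu1 h < ∞) : ∃ π : ℕ → ℝ, IsEquilibrium (Qtilde c b h) π := by
  set Z := 1 + restartBusy c b h 0
  set ν : ℕ → ℝ≥0∞ := fun j => Z⁻¹ * invariantMeasure c b h j
  have hZ : Z ≠ ∞ := ENNReal.add_ne_top.2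
    ⟨ENNReal.one_ne_top, hm.restartBusy_zero_left_ne_top hneg hmu⟩
  have hsum : ∑' j, ν j = 1 := by
    rw [ENNReal.tsum_mul_left, hm.tsum_invariantMeasure, ENNReal.inv_mul_cancel (by simp [Z]) hZ]
  have hν : ∀ j, ν j ≠ ∞ := ENNReal.ne_top_of_tsum_ne_top (hsum.trans_ne ENNReal.one_ne_top)
  refine ⟨fun j => (ν j).toReal, (hm.isEquilibrium_iff fun _ => ENNReal.toReal_nonneg).2 ?_⟩
  simp only [ENNReal.ofReal_toReal (hν _)]
  exact ⟨hsum, (hm.isInvariant_invariantMeasure hneg).const_mul Z⁻¹⟩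

end Equilibrium

end MXMc

end

theorem theorem4p7 {c : ℕ} {b h : ℕ → ℝ} (hmodel : MXMc.IsModel c b h)
    {Ω : ℝ → ℕ → Type*} [∀ β j, MeasurableSpace (Ω β j)]
    (P : ∀ β j, Measure (Ω β j)) (M : ∀ β j, ℝ≥0 → Ω β j → Option ℕ)
    (hM : ∀ β : ℝ, 0 < β → ∀ j : ℕ,
      MXMc.IsQProcess (MXMc.QM c b h β) (some j) (P β j) (M β j))
    (C : ∀ β j, Ω β j → ℝ≥0∞)
    (hC : ∀ β j ω, C β j ω = MXMc.hittingTime (M β j) none ω)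
    (EC : ℝ → ℕ → ℝ≥0∞) (hEC : ∀ β j, EC β j = ∫⁻ ω, C β j ω ∂(P β j)) :
    -- the quantities in the limits below are finite
    (∀ β : ℝ, 0 < β → ∀ j : ℕ, EC β j ≠ ∞) ∧
    (∀ k i : ℕ, 1 ≤ k → 1 ≤ i → MXMc.mstar c b k i ≠ ∞) ∧
    (∀ k : ℕ, 1 ≤ k → MXMc.r c b h k ≠ ∞) ∧
    -- `β ↓ 0`, positive recurrent case
    (MXMc.BiDerivOne b c < 0 → MXMc.mu1 h < ∞ →
      (∀ j : ℕ, Tendsto (fun β : ℝ => β * (EC β j).toReal) (𝓝[>] 0)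
        (𝓝 ((-(MXMc.BiDerivOne b c).toReal + (MXMc.mu1 h).toReal + MXMc.rSum c b h) /
          ((MXMc.mu1 h).toReal + MXMc.rSum c b h)))) ∧
      (∃ π : ℕ → ℝ, MXMc.IsEquilibrium (MXMc.Qtilde c b h) π) ∧
      (∀ π : ℕ → ℝ, MXMc.IsEquilibrium (MXMc.Qtilde c b h) π → π 0 < 1 ∧
        ∀ j : ℕ, Tendsto (fun β : ℝ => β * (EC β j).toReal) (𝓝[>] 0) (𝓝 (1 / (1 - π 0))))) ∧
    -- `β ↓ 0`, transient case
    (0 < MXMc.BiDerivOne b c →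
      Tendsto (fun β : ℝ => (EC β 0).toReal - 1 / β) (𝓝[>] 0)
        (𝓝 (1 / MXMc.transientDenom c b h)) ∧
      ∀ j : ℕ, 1 ≤ j → Tendsto (fun β : ℝ => (EC β j).toReal - 1 / β) (𝓝[>] 0)
        (𝓝 (b 0 * (MXMc.mstar c b 1 j).toReal / MXMc.transientDenom c b h))) ∧
    -- `β → ∞`
    Tendsto (fun β : ℝ => (EC β 0).toReal) atTop (𝓝 (1 / ∑' k, h k)) ∧
    Tendsto (fun β : ℝ => β * (EC β 1).toReal) atTop (𝓝 (1 + b 0 / ∑' k, h k)) ∧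
    (∀ j : ℕ, 2 ≤ j → Tendsto (fun β : ℝ => β * (EC β j).toReal) atTop (𝓝 1)) := by
  have hE (β : ℝ) (hβ : 0 < β) (j : ℕ) : EC β j = MXMc.catastropheTime c b h β j := by
    simp only [hEC, hC, hmodel.lintegral_hittingTime_none hβ (hM β hβ j)]
  have transfer {l : Filter ℝ} (hl : ∀ᶠ β in l, 0 < β) (f : ℝ → ℝ≥0∞ → ℝ) {j : ℕ} {y : ℝ}
      (hf : Tendsto (fun β => f β (MXMc.catastropheTime c b h β j)) l (𝓝 y)) :
      Tendsto (fun β => f β (EC β j)) l (𝓝 y) :=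
    hf.congr' (hl.mono fun β hβ => congrArg (f β) (hE β hβ j).symm)
  have hzero := transfer (eventually_mem_nhdsWithin (a := 0) (s := Set.Ioi 0))
  have hinfty := transfer (eventually_gt_atTop 0)
  refine ⟨fun β hβ j => (hE β hβ j).trans_ne (hmodel.catastropheTime_ne_top hβ j),
    fun k i hk _ => (hmodel.mstar_eq_green (by omega) i).trans_ne (hmodel.green_ne_top k i),
    fun k hk => hmodel.r_ne_top (by omega), fun hneg hmu => ⟨fun j => ?_,
      hmodel.exists_isEquilibrium hneg hmu,
      fun π hπ => ⟨hmodel.equilibrium_zero_lt_one hneg hmu hπ, fun j => ?_⟩⟩,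
    fun hpos => ⟨?_, fun j hj => ?_⟩, ?_, ?_, fun j hj => ?_⟩
  · exact hzero (fun β x => β * x.toReal) (hmodel.tendsto_mul_catastropheTime_drift hneg hmu j)
  · exact hzero (fun β x => β * x.toReal)
      (hmodel.tendsto_mul_catastropheTime_equilibrium hneg hmu hπ j)
  · exact hzero (fun β x => x.toReal - 1 / β) (hmodel.tendsto_catastropheTime_zero_sub hpos)
  · exact hzero (fun β x => x.toReal - 1 / β)
      (hmodel.tendsto_catastropheTime_sub_of_ne_zero hpos (by omega))
  · exact hinfty (fun _ x => x.toReal) hmodel.tendsto_toReal_catastropheTime_zero_atTop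
  · exact hinfty (fun β x => β * x.toReal) hmodel.tendsto_mul_toReal_catastropheTime_one_atTop
  · obtain ⟨j, rfl⟩ := Nat.exists_eq_add_of_le' hj
    exact hinfty (fun β x => β * x.toReal)
      (hmodel.tendsto_mul_toReal_catastropheTime_add_two_atTop j)
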